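/- Let $\mathbb{K}$ be a local field of characteristic zero, i.e. a field of characteristic zero that is locally compact for the topology of a nontrivial absolute value (equivalently $\mathbb{R}$, $\mathbb{C}$, or a finite extension of some $\mathbb{Q}_p$). Let $G$ be a linear algebraic group over $\mathbb{K}$, meaning the group of $\mathbb{K}$-points of a linear algebraic group defined over $\mathbb{K}$, i.e. a subgroup of some $GL_n(\mathbb{K})$ that is the set of common zeros in $GL_n(\mathbb{K})$ of a family of polynomials over $\mathbb{K}$ in the matrix entries, with the topology induced by that of $\mathbb{K}$. Let $H\subseteq G$ be an algebraic subgroup of $G$ (a subgroup defined by polynomials over $\mathbb{K}$ in the same sense). Let $G$ act on $G/H$ (with the quotient topology) by left translation, and let $\mu$ be a Borel probability measure on $G/H$, with support $S(\mu)$, the set of points all of whose neighbourhoods have positive measure. Put $$\mathcal{I}(\mu)=\{g\in G : g\mu=\mu\},\qquad I(\mu)=\{g\in G : gx=x \text{ for all } x\in S(\mu)\},$$ where $g\mu$ is the image of $\mu$ under $x\mapsto gx$. Then $I(\mu)$ is a normal subgroup of $\mathcal{I}(\mu)$, and the quotient $\mathcal{I}(\mu)/I(\mu)$, with the quotient topology,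 is a compact (Hausdorff) group. -/

import Mathlib

open MeasureTheory

/-- A subgroup `G` of `GL_n(K)` is *algebraic over `K`* if it is the set of common zeros in
`GL_n(K)` of a family of polynomials in the matrix entries with coefficients in `K`.
(The `K`-points of an algebraic subgroup of `GL_n` defined over `K` are of this form, and over a
field of characteristic zero every such `G` arises in this way from its Zariski closure.
Allowing `1 / det` in the equations gives the same subgroups, as denominators can be cleared.) -/
def IsAlgebraicSubgroup {K : Type*} [Field K] {n : ℕ} (G : Subgroup (GL (Fin n) K)) : Prop :=
  ∃ S : Set (MvPolynomial (Fin n × Fin n) K), ∀ g : GL (Fin n) K,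
    g ∈ G ↔ ∀ p ∈ S,
      MvPolynomial.eval (fun ij : Fin n × Fin n => (g : Matrix (Fin n) (Fin n) K) ij.1 ij.2) p = 0

/-- The subgroup of those `g` in `G` whose action on `X` preserves the Borel measure `μ`,
that is, for which the image of `μ` under `x ↦ g • x` is `μ`. -/
def measureStabilizer (G : Type*) {X : Type*} [Group G] [MulAction G X] [TopologicalSpace X]
    [ContinuousConstSMul G X] [MeasurableSpace X] [BorelSpace X] (μ : Measure X) :
    Subgroup G where
  carrier := {g : G | μ.map (fun x : X => g • x) = μ}
  one_mem' := by simp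
  mul_mem' := by
    intro a b ha hb
    simp only [Set.mem_ofPred_eq] at ha hb ⊢
    have h : (fun x : X => (a * b) • x) = (fun x => a • x) ∘ (fun x => b • x) := by
      funext x; simp [mul_smul]
    rw [h, ← Measure.map_map (continuous_const_smul a).measurable
      (continuous_const_smul b).measurable, hb, ha]
  inv_mem' := by
    intro a ha
    simp only [Set.mem_ofPred_eq] at ha ⊢
    conv_lhs => rw [← ha]
    rw [Measure.map_map (continuous_const_smul a⁻¹).measurable
      (continuous_const_smul a).measurable]
    have h : (fun x : X => a⁻¹ • x) ∘ (fun x => a • x) = id := by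
      funext x; simp
    rw [h, Measure.map_id]

/-- The subgroup of those `g` in `G` that fix every point of the (topological) support of `μ`. -/
def supportFixer (G : Type*) {X : Type*} [Group G] [MulAction G X] [TopologicalSpace X]
    [MeasurableSpace X] (μ : Measure X) : Subgroup G :=
  fixingSubgroup G μ.support

/-! Write `X = G ⧸ H`. Given elements `s i` preserving `μ`, a subsequence has to converge modulo the
fixer of the support. Each `s i` acts diagonally on the space of sequences in `X` and preserves the
infinite power of `μ`. A recurrence argument inside a compact set of positive measure yields a
sequence `x` whose closure contains the support, and a subsequence of translates `s i • x`
converging to some `y` (`exists_recurrent_sequence`). By Noetherianity, an element fixing finitely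
many suitable entries of `x` fixes all of them, hence the support, so only a finite tuple matters
(`IsAlgebraicSubgroup.exists_forall_conj_mem`).

The danger is that `y` falls into a smaller orbit in the boundary of the orbit of `x`. This is
excluded by keeping a measurable invariant constant in the limit: the dimensions, in each degree, of
the spaces of polynomials vanishing on the orbit. If they agree for `x` and `y`, both orbits have
the same Zariski closure. Orbits are open in their Zariski closure and orbit maps are open
(`eventually_mem_tupleOrbit`), so `s i • x = c i • y` on the finite tuple with `c i → 1`. Hence `y =
g • x` there, and `s i` agrees with `c i * g` modulo the fixer, which gives convergence to the class
of `g`.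

Openness of orbits rests on a statement about `K`-points: a dominant map of varieties is open at
some point as soon as the `K`-points of the source are Zariski dense (`exists_restrictionOpenAt`).
Points are treated as algebra homomorphisms to `K` with pointwise convergence, and the ring is built
up by one generator at a time. Homogeneity then carries openness from one point to the whole orbit.
-/

open Filter Topology

/-! ### Generic openness of dominant maps on `K`-points. -/

section AlgebraicOpenness

/-- The neighbourhood filter of an algebra homomorphism `Φ : A → K` for the topology of pointwise
convergence. -/
def nhdsHom {K A : Type*} [NontriviallyNormedField K] [CommRing A] [Algebra K A]
    (Φ : A →ₐ[K] K) : Filter (A →ₐ[K] K) :=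
  comap (fun Ψ a => Ψ a) (𝓝 (fun a => Φ a))

/-- Restriction along `f : B → A` maps neighbourhoods of `Φ₀` to neighbourhoods of `Φ₀ ∘ f`. -/
def RestrictionOpenAt {K A B : Type*} [NontriviallyNormedField K] [CommRing A] [Algebra K A]
    [CommRing B] [Algebra K B] (f : B →ₐ[K] A) (Φ₀ : A →ₐ[K] K) : Prop :=
  ∀ S ∈ nhdsHom Φ₀, ∀ᶠ ψ in nhdsHom (Φ₀.comp f), ∃ Φ ∈ S, Φ.comp f = ψ

/-- Restriction along `f : B → A` is open at every point where some fixed nonzero function does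
not vanish. -/
def GenericallyOpen {K A B : Type*} [NontriviallyNormedField K] [CommRing A] [Algebra K A]
    [CommRing B] [Algebra K B] (f : B →ₐ[K] A) : Prop :=
  ∃ h : A, h ≠ 0 ∧ ∀ Φ₀ : A →ₐ[K] K, Φ₀ h ≠ 0 → RestrictionOpenAt f Φ₀

variable {K A B C : Type*} [NontriviallyNormedField K] [CommRing A] [Algebra K A]
    [CommRing B] [Algebra K B] [CommRing C] [Algebra K C]

theorem tendsto_nhdsHom_iff {ι : Type*} {l : Filter ι} {u : ι → A →ₐ[K] K} {Φ : A →ₐ[K] K} :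
    Tendsto u l (nhdsHom Φ) ↔ ∀ a, Tendsto (fun i => u i a) l (𝓝 (Φ a)) := by
  rw [nhdsHom, tendsto_comap_iff, tendsto_pi_nhds]
  rfl

theorem tendsto_eval_nhdsHom (Φ : A →ₐ[K] K) (a : A) :
    Tendsto (fun Ψ : A →ₐ[K] K => Ψ a) (nhdsHom Φ) (𝓝 (Φ a)) :=
  tendsto_nhdsHom_iff.1 tendsto_id a

theorem tendsto_comp_nhdsHom (f : B →ₐ[K] A) (Φ : A →ₐ[K] K) :
    Tendsto (fun Ψ : A →ₐ[K] K => Ψ.comp f) (nhdsHom Φ) (nhdsHom (Φ.comp f)) :=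
  tendsto_nhdsHom_iff.2 fun b => tendsto_eval_nhdsHom Φ (f b)

theorem RestrictionOpenAt.comp {f : B →ₐ[K] A} {g : C →ₐ[K] B} {Φ : A →ₐ[K] K}
    (hf : RestrictionOpenAt f Φ) (hg : RestrictionOpenAt g (Φ.comp f)) :
    RestrictionOpenAt (f.comp g) Φ := by
  intro S hS
  filter_upwards [hg _ (hf S hS)] with ψ ⟨Ψ, ⟨Φ', hΦ', h1⟩, h2⟩
  exact ⟨Φ', hΦ', by rw [← h2, ← h1]; rfl⟩

theorem GenericallyOpen.comp [IsDomain A] {f : B →ₐ[K] A} {g : C →ₐ[K] B}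
    (hfi : Function.Injective f) (hf : GenericallyOpen f) (hg : GenericallyOpen g) :
    GenericallyOpen (f.comp g) := by
  obtain ⟨h, h0, H⟩ := hf
  obtain ⟨k, k0, H'⟩ := hg
  refine ⟨h * f k, mul_ne_zero h0 ((map_ne_zero_iff f hfi).2 k0), fun Φ hΦ => ?_⟩
  rw [map_mul] at hΦ
  exact (H Φ (left_ne_zero_of_mul hΦ)).comp (H' _ (right_ne_zero_of_mul hΦ))

theorem genericallyOpen_of_bijective [Nontrivial A] {f : B →ₐ[K] A} (hf : Function.Bijective f) :
    GenericallyOpen f := by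
  refine ⟨1, one_ne_zero, fun Φ _ S hS => ?_⟩
  let e : B ≃ₐ[K] A := AlgEquiv.ofBijective f hf
  have key : ∀ ψ : B →ₐ[K] K, (ψ.comp (e.symm : A →ₐ[K] B)).comp f = ψ := by
    intro ψ
    ext b
    change ψ (e.symm (e b)) = ψ b
    rw [e.symm_apply_apply]
  have ht : Tendsto (fun ψ : B →ₐ[K] K => ψ.comp (e.symm : A →ₐ[K] B)) (nhdsHom (Φ.comp f))
      (nhdsHom Φ) := by
    refine tendsto_nhdsHom_iff.2 fun a => ?_
    have := tendsto_eval_nhdsHom (Φ.comp f) (e.symm a)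
    have h2 : (Φ.comp f) (e.symm a) = Φ a := by
      change Φ (e (e.symm a)) = Φ a
      rw [e.apply_symm_apply]
    rw [h2] at this
    exact this
  filter_upwards [ht hS] with ψ hψ
  exact ⟨_, hψ, key ψ⟩

/-- Simple roots of polynomials depend continuously on the coefficients. -/
theorem eventually_exists_root [CompleteSpace K] (ψ₀ : B →ₐ[K] K) (q : Polynomial B) (τ₀ : K)
    (h0 : q.eval₂ (ψ₀ : B →+* K) τ₀ = 0) (h1 : q.derivative.eval₂ (ψ₀ : B →+* K) τ₀ ≠ 0)
    {T : Set K} (hT : T ∈ 𝓝 τ₀) :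
    ∀ᶠ ψ : B →ₐ[K] K in nhdsHom ψ₀, ∃ τ ∈ T, q.eval₂ (ψ : B →+* K) τ = 0 := by
  set N := q.natDegree + 1 with hN
  let c : (B →ₐ[K] K) → (Fin N → K) := fun ψ i => ψ (q.coeff i)
  have hev : ∀ (ψ : B →ₐ[K] K) (τ : K),
      q.eval₂ (ψ : B →+* K) τ = ∑ i : Fin N, c ψ i * τ ^ (i : ℕ) := by
    intro ψ τ
    rw [Polynomial.eval₂_eq_sum_range, Finset.sum_range]
    rfl
  -- Keeping the coefficients as a component of the map turns the implicit function theorem into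
  -- local surjectivity of `F`: at a simple root the derivative of `F` is onto.
  let F : (Fin N → K) × K → (Fin N → K) × K := fun p => (p.1, ∑ i : Fin N, p.1 i * p.2 ^ (i : ℕ))
  let L : ((Fin N → K) × K) →L[K] K := ∑ i : Fin N,
    ((τ₀ ^ (i : ℕ)) • ((ContinuousLinearMap.proj i).comp (ContinuousLinearMap.fst K (Fin N → K) K))
      + (c ψ₀ i * ((i : ℕ) * τ₀ ^ ((i : ℕ) - 1))) • ContinuousLinearMap.snd K (Fin N → K) K)
  have hF : HasStrictFDerivAt F ((ContinuousLinearMap.fst K (Fin N → K) K).prod L)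
      (c ψ₀, τ₀) := by
    refine HasStrictFDerivAt.prodMk hasStrictFDerivAt_fst ?_
    refine HasStrictFDerivAt.fun_sum fun i _ => ?_
    have a1 : HasStrictFDerivAt (fun p : (Fin N → K) × K => p.1 i)
        ((ContinuousLinearMap.proj i).comp (ContinuousLinearMap.fst K (Fin N → K) K))
        (c ψ₀, τ₀) :=
      ((ContinuousLinearMap.proj (R := K) (φ := fun _ : Fin N => K) i).comp
        (ContinuousLinearMap.fst K (Fin N → K) K)).hasStrictFDerivAt
    have a2 : HasStrictFDerivAt (fun p : (Fin N → K) × K => p.2 ^ (i : ℕ))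
        (((i : ℕ) * τ₀ ^ ((i : ℕ) - 1)) • ContinuousLinearMap.snd K (Fin N → K) K)
        (c ψ₀, τ₀) :=
      (hasStrictDerivAt_pow (i : ℕ) τ₀).comp_hasStrictFDerivAt (c ψ₀, τ₀) hasStrictFDerivAt_snd
    refine (a1.fun_mul a2).congr_fderiv ?_
    change c ψ₀ i • (((i : ℕ) : K) * τ₀ ^ ((i : ℕ) - 1)) • ContinuousLinearMap.snd K (Fin N → K) K
      + τ₀ ^ (i : ℕ) •
        ((ContinuousLinearMap.proj i).comp (ContinuousLinearMap.fst K (Fin N → K) K)) = _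
    rw [smul_smul, add_comm]
  have hL : ∀ t : K, L (0, t) = q.derivative.eval₂ (ψ₀ : B →+* K) τ₀ * t := by
    intro t
    have : q.derivative.eval₂ (ψ₀ : B →+* K) τ₀ =
        ∑ i : Fin N, c ψ₀ i * ((i : ℕ) * τ₀ ^ ((i : ℕ) - 1)) := by
      conv_lhs => rw [q.as_sum_range_C_mul_X_pow]
      rw [Polynomial.derivative_sum, Polynomial.eval₂_finsetSum, Finset.sum_range]
      refine Finset.sum_congr rfl fun i _ => ?_
      rw [Polynomial.derivative_C_mul_X_pow, Polynomial.eval₂_mul, Polynomial.eval₂_C,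
        Polynomial.eval₂_X_pow]
      simp [c, mul_assoc]
    rw [this, Finset.sum_mul]
    simp [L]
  have hsurj : ((ContinuousLinearMap.fst K (Fin N → K) K).prod L).range = ⊤ := by
    rw [LinearMap.range_eq_top]
    rintro ⟨a, b⟩
    refine ⟨(a, (q.derivative.eval₂ (ψ₀ : B →+* K) τ₀)⁻¹ * (b - L (a, 0))), ?_⟩
    refine Prod.ext rfl ?_
    change L _ = b
    have : ∀ t : K, L (a, t) = L (a, 0) + L (0, t) := by
      intro t
      rw [← map_add]; simp
    rw [this, hL, mul_inv_cancel_left₀ h1]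
    ring
  have hmap := hF.map_nhds_eq_of_surj hsurj
  have hval : F (c ψ₀, τ₀) = (c ψ₀, 0) := by
    refine Prod.ext rfl ?_
    change ∑ i : Fin N, c ψ₀ i * τ₀ ^ (i : ℕ) = 0
    rw [← hev, h0]
  rw [hval] at hmap
  have hmem : F '' (Set.univ ×ˢ T) ∈ 𝓝 (c ψ₀, (0 : K)) := by
    rw [← hmap]
    exact image_mem_map (prod_mem_nhds univ_mem hT)
  have hc : Tendsto (fun ψ => (c ψ, (0 : K))) (nhdsHom ψ₀) (𝓝 (c ψ₀, 0)) :=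
    (tendsto_pi_nhds.2 fun i => tendsto_eval_nhdsHom ψ₀ _).prodMk_nhds tendsto_const_nhds
  filter_upwards [hc hmem] with ψ ⟨⟨a, τ⟩, ⟨_, hτ⟩, hEq⟩
  refine ⟨τ, hτ, ?_⟩
  have e1 : a = c ψ := congrArg Prod.fst hEq
  have e2 : ∑ i : Fin N, a i * τ ^ (i : ℕ) = 0 := congrArg Prod.snd hEq
  rw [hev, ← e1, e2]

/-- A homomorphism extends along a simple extension once a compatible value of the generator
is chosen; the extension depends continuously on this value. -/
theorem RestrictionOpenAt.of_simple {f : B →ₐ[K] A} {x : A}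
    (hx : ∀ a, ∃ r : Polynomial B, r.eval₂ (f : B →+* A) x = a) (Φ₀ : A →ₐ[K] K)
    (H : ∀ T ∈ 𝓝 (Φ₀ x), ∀ᶠ ψ : B →ₐ[K] K in nhdsHom (Φ₀.comp f), ∃ τ ∈ T,
      ∀ r : Polynomial B, r.eval₂ (f : B →+* A) x = 0 → r.eval₂ (ψ : B →+* K) τ = 0) :
    RestrictionOpenAt f Φ₀ := by
  intro S hS
  choose r hr using hx
  rw [nhdsHom, mem_comap] at hS
  obtain ⟨V, hV, hVS⟩ := hS
  have hcont : Tendsto (fun (p : (B →ₐ[K] K) × K) a => (r a).eval₂ (p.1 : B →+* K) p.2)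
      (nhdsHom (Φ₀.comp f) ×ˢ 𝓝 (Φ₀ x)) (𝓝 (fun a => Φ₀ a)) := by
    refine tendsto_pi_nhds.2 fun a => ?_
    have h1 : Φ₀ a = ∑ i ∈ Finset.range ((r a).natDegree + 1),
        (Φ₀.comp f) ((r a).coeff i) * Φ₀ x ^ i := by
      conv_lhs => rw [← hr a]
      rw [Polynomial.eval₂_eq_sum_range, map_sum]
      simp
    simp only [Polynomial.eval₂_eq_sum_range]
    rw [h1]
    refine tendsto_finsetSum _ fun i _ => ?_
    exact ((tendsto_eval_nhdsHom (Φ₀.comp f) _).comp tendsto_fst).mul (tendsto_snd.pow i)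
  obtain ⟨S₁, hS₁, T, hT, hST⟩ := mem_prod_iff.1 (hcont hV)
  filter_upwards [H T hT, hS₁] with ψ ⟨τ, hτ, hker⟩ hψ
  -- Since `τ` satisfies every relation of `x`, the value does not depend on the polynomial chosen
  -- to represent `a`; this makes `Φ` a homomorphism.
  have hval : ∀ (p : Polynomial B) (a : A), p.eval₂ (f : B →+* A) x = a →
      (r a).eval₂ (ψ : B →+* K) τ = p.eval₂ (ψ : B →+* K) τ := by
    intro p a hp
    rw [← sub_eq_zero, ← Polynomial.eval₂_sub]
    exact hker _ (by rw [Polynomial.eval₂_sub, hr, hp, sub_self])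
  have hf : ∀ b : B, (r (f b)).eval₂ (ψ : B →+* K) τ = ψ b := fun b => by
    rw [hval (Polynomial.C b) _ (by simp)]; simp
  let Φ : A →ₐ[K] K :=
    { toFun := fun a => (r a).eval₂ (ψ : B →+* K) τ
      map_one' := by rw [hval 1 1 (by simp)]; simp
      map_mul' := fun a b => by
        rw [hval (r a * r b) (a * b) (by rw [Polynomial.eval₂_mul, hr, hr]), Polynomial.eval₂_mul]
      map_zero' := by rw [hval 0 0 (by simp)]; simp
      map_add' := fun a b => by
        rw [hval (r a + r b) (a + b) (by rw [Polynomial.eval₂_add, hr, hr]), Polynomial.eval₂_add]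
      commutes' := fun k => by rw [← f.commutes k, hf, ψ.commutes] }
  exact ⟨Φ, hVS (hST (Set.mk_mem_prod hψ hτ)), AlgHom.ext hf⟩

/-- If `x` is transcendental over `B`, its value is unconstrained and can be kept. If it is
algebraic, take a relation `q` of least degree. Characteristic zero and minimality make `q'(x)`
nonzero, so where this does not vanish the root of `q` moves continuously. Where the leading
coefficient does not vanish either, pseudo-division by `q` shows that this root satisfies all other
relations of `x`. -/
theorem genericallyOpen_of_simple [CompleteSpace K] [CharZero K] [IsDomain A] {f : B →ₐ[K] A}
    (hf : Function.Injective f) {x : A}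
    (hx : ∀ a, ∃ r : Polynomial B, r.eval₂ (f : B →+* A) x = a) : GenericallyOpen f := by
  by_cases hal : ∃ q : Polynomial B, q ≠ 0 ∧ q.eval₂ (f : B →+* A) x = 0
  · obtain ⟨q, ⟨hq0, hqx⟩, hmin⟩ := WellFounded.has_min (measure Polynomial.natDegree).wf
      {q : Polynomial B | q ≠ 0 ∧ q.eval₂ (f : B →+* A) x = 0} hal
    have hmin' : ∀ r : Polynomial B, r.eval₂ (f : B →+* A) x = 0 → r.natDegree < q.natDegree →
        r = 0 := by
      intro r hr hlt
      by_contra h0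
      exact hmin r ⟨h0, hr⟩ hlt
    have hdeg : q.natDegree ≠ 0 := by
      intro h
      rw [Polynomial.eq_C_of_natDegree_eq_zero h, Polynomial.eval₂_C] at hqx
      have h2 : q.coeff 0 = 0 := hf (by rw [map_zero]; exact hqx)
      exact hq0 (by rw [Polynomial.eq_C_of_natDegree_eq_zero h, h2, Polynomial.C_0])
    have hlead : f q.leadingCoeff ≠ 0 := by
      rw [map_ne_zero_iff f hf]
      exact Polynomial.leadingCoeff_ne_zero.2 hq0
    have hder : q.derivative.eval₂ (f : B →+* A) x ≠ 0 := by
      intro h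
      have h2 := hmin' _ h (Polynomial.natDegree_derivative_lt hdeg)
      have h3 : (q.derivative).coeff (q.natDegree - 1) = 0 := by rw [h2, Polynomial.coeff_zero]
      rw [Polynomial.coeff_derivative, Nat.sub_add_cancel (Nat.one_le_iff_ne_zero.2 hdeg)] at h3
      have h4 : f q.leadingCoeff * algebraMap K A ((q.natDegree : K)) = 0 := by
        have h5 := congrArg f h3
        rw [map_zero, map_mul] at h5
        rw [map_natCast, ← h5, Polynomial.leadingCoeff]
        congr 1
        have : ((q.natDegree - 1 : ℕ) : B) + 1 = ((q.natDegree : ℕ) : B) := by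
          exact_mod_cast congrArg (Nat.cast (R := B))
            (Nat.sub_add_cancel (Nat.one_le_iff_ne_zero.2 hdeg))
        rw [this, map_natCast]
      rcases mul_eq_zero.1 h4 with h5 | h5
      · exact hlead h5
      · rw [map_eq_zero_iff _ (algebraMap K A).injective] at h5
        exact hdeg (by exact_mod_cast h5)
    refine ⟨f q.leadingCoeff * q.derivative.eval₂ (f : B →+* A) x, mul_ne_zero hlead hder,
      fun Φ₀ hΦ => ?_⟩
    rw [map_mul] at hΦ
    have hev : ∀ p : Polynomial B, p.eval₂ ((Φ₀.comp f : B →ₐ[K] K) : B →+* K) (Φ₀ x)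
        = Φ₀ (p.eval₂ (f : B →+* A) x) := by
      intro p
      rw [Polynomial.eval₂_eq_sum_range, Polynomial.eval₂_eq_sum_range, map_sum]
      simp
    refine RestrictionOpenAt.of_simple hx Φ₀ fun T hT => ?_
    have hlc : ∀ᶠ ψ : B →ₐ[K] K in nhdsHom (Φ₀.comp f), ψ q.leadingCoeff ≠ 0 :=
      (tendsto_eval_nhdsHom (Φ₀.comp f) q.leadingCoeff).eventually_ne (left_ne_zero_of_mul hΦ)
    filter_upwards [hlc, eventually_exists_root (Φ₀.comp f) q (Φ₀ x)
      (by rw [hev, hqx, map_zero]) (by rw [hev]; exact right_ne_zero_of_mul hΦ) hT]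
      with ψ hψ ⟨τ, hτ, hroot⟩
    refine ⟨τ, hτ, fun r hr => ?_⟩
    induction hn : r.natDegree using Nat.strong_induction_on generalizing r with
    | _ k ih =>
      by_cases hlt : r.natDegree < q.natDegree
      · rw [hmin' r hr hlt, Polynomial.eval₂_zero]
      · push Not at hlt
        -- One step of pseudo-division: the top terms cancel, so `s` is a relation that is zero or
        -- of smaller degree.
        set s : Polynomial B := Polynomial.C q.leadingCoeff * r -
          Polynomial.C r.leadingCoeff * Polynomial.X ^ (r.natDegree - q.natDegree) * q with hs
        have hsx : s.eval₂ (f : B →+* A) x = 0 := by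
          simp [hs, Polynomial.eval₂_sub, Polynomial.eval₂_mul, hr, hqx]
        have hsτ : s.eval₂ (ψ : B →+* K) τ = ψ q.leadingCoeff * r.eval₂ (ψ : B →+* K) τ := by
          simp [hs, Polynomial.eval₂_sub, Polynomial.eval₂_mul, hroot]
        have hzero : s.eval₂ (ψ : B →+* K) τ = 0 := by
          by_cases hs0 : s = 0
          · rw [hs0, Polynomial.eval₂_zero]
          · refine ih s.natDegree ?_ s hsx rfl
            rw [← hn]
            have hr0 : r.natDegree ≠ 0 := by omega
            have hle : s.natDegree ≤ r.natDegree := by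
              refine (Polynomial.natDegree_sub_le _ _).trans (max_le ?_ ?_)
              · exact Polynomial.natDegree_C_mul_le _ _
              · refine Polynomial.natDegree_mul_le.trans ?_
                have := Polynomial.natDegree_C_mul_X_pow_le r.leadingCoeff
                  (r.natDegree - q.natDegree)
                omega
            refine lt_of_le_of_ne hle fun heq => hs0 ?_
            rw [← Polynomial.leadingCoeff_eq_zero, Polynomial.leadingCoeff, heq, hs,
              Polynomial.coeff_sub, Polynomial.coeff_C_mul, mul_assoc, Polynomial.coeff_C_mul,
              Polynomial.coeff_X_pow_mul', if_pos (Nat.sub_le _ _), Nat.sub_sub_self hlt,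
              Polynomial.leadingCoeff, Polynomial.leadingCoeff]
            ring
        rw [hsτ] at hzero
        exact (mul_eq_zero.1 hzero).resolve_left hψ
  · push Not at hal
    refine ⟨1, one_ne_zero, fun Φ₀ _ => RestrictionOpenAt.of_simple hx Φ₀ fun T hT => ?_⟩
    refine Eventually.of_forall fun ψ => ⟨Φ₀ x, mem_of_mem_nhds hT, fun r hr => ?_⟩
    by_cases h0 : r = 0
    · rw [h0, Polynomial.eval₂_zero]
    · exact absurd hr (hal r h0)

universe u in
-- Replaces a subalgebra by an abstract algebra with an embedding, the form in which the
-- intermediate rings enter the induction on generators.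
theorem exists_algHom_range_eq {K : Type*} {A : Type u} [Field K] [CommRing A]
    [Algebra K A] (E : Subalgebra K A) :
    ∃ (T : Type u) (_ : CommRing T) (_ : Algebra K T) (j : T →ₐ[K] A),
      Function.Injective j ∧ j.range = E :=
  ⟨E, inferInstance, inferInstance, E.val, Subtype.val_injective, E.range_val⟩

theorem exists_comp_eq_of_range_le (j : B →ₐ[K] A) (i : C →ₐ[K] A) (hi : Function.Injective i)
    (h : j.range ≤ i.range) : ∃ f : B →ₐ[K] C, i.comp f = j := by
  have hex : ∀ b, ∃ c, i c = j b := fun b => h ⟨b, rfl⟩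
  choose f hf using hex
  refine ⟨⟨⟨⟨⟨f, hi ?_⟩, fun x y => hi ?_⟩, hi ?_, fun x y => hi ?_⟩, fun k => hi ?_⟩,
    AlgHom.ext hf⟩ <;> simp [hf]

theorem genericallyOpen_of_range_eq_sup_adjoin [CompleteSpace K] [CharZero K] [IsDomain A]
    (j : B →ₐ[K] A) (i : C →ₐ[K] A) (hj : Function.Injective j) (hi : Function.Injective i)
    {x : A} (h : i.range = j.range ⊔ Algebra.adjoin K {x}) {f : B →ₐ[K] C} (hf : i.comp f = j) :
    GenericallyOpen f := by
  have hdom : IsDomain C := hi.isDomain (i : C →+* A)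
  have hx : x ∈ i.range := h ▸ le_sup_right (a := j.range) (Algebra.subset_adjoin rfl)
  obtain ⟨c, hc⟩ := hx
  refine genericallyOpen_of_simple (x := c)
    (Function.Injective.of_comp (f := i) (by rw [← AlgHom.coe_comp, hf]; exact hj)) fun a => ?_
  let e : Polynomial B →ₐ[K] A :=
    { Polynomial.eval₂RingHom (j : B →+* A) x with
      commutes' := fun k => (Polynomial.eval₂_C _ _).trans (j.commutes k) }
  have hmem : i.range ≤ e.range := by
    rw [h]
    refine sup_le ?_ (Algebra.adjoin_le ?_)
    · rintro _ ⟨b, rfl⟩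
      exact ⟨Polynomial.C b, Polynomial.eval₂_C _ _⟩
    · rintro _ rfl
      exact ⟨Polynomial.X, Polynomial.eval₂_X _ _⟩
  obtain ⟨r, hr⟩ := hmem ⟨a, rfl⟩
  refine ⟨r, hi ?_⟩
  refine Eq.trans ?_ hr
  change (i : C →+* A) _ = Polynomial.eval₂ (j : B →+* A) x r
  rw [Polynomial.hom_eval₂, ← hf]
  congr 1

universe u in
-- Induction on the generators adjoined to `B`. The intermediate ring `C` varies, but all rings
-- embed in the fixed domain `A`, so each step is a simple extension of domains.
theorem genericallyOpen_of_range_eq_sup_finset [CompleteSpace K] [CharZero K]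
    {A : Type u} [CommRing A] [Algebra K A] [IsDomain A]
    (j : B →ₐ[K] A) (hj : Function.Injective j) (s : Finset A) :
    ∀ {C : Type u} [CommRing C] [Algebra K C] (i : C →ₐ[K] A) (_ : Function.Injective i)
      (_ : i.range = j.range ⊔ Algebra.adjoin K (s : Set A)) (f : B →ₐ[K] C) (_ : i.comp f = j),
      GenericallyOpen f := by
  classical
  induction s using Finset.induction_on with
  | empty =>
    intro C _ _ i hi h f hf
    have hdom : IsDomain C := hi.isDomain (i : C →+* A)
    rw [Finset.coe_empty, Algebra.adjoin_empty, sup_bot_eq] at h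
    refine genericallyOpen_of_bijective ⟨?_, fun c => ?_⟩
    · exact Function.Injective.of_comp (f := i) (by rw [← AlgHom.coe_comp, hf]; exact hj)
    · obtain ⟨b, hb⟩ : i c ∈ j.range := h ▸ ⟨c, rfl⟩
      refine ⟨b, hi ?_⟩
      rw [← hb, ← hf]
      rfl
  | insert x s _ ih =>
    intro C _ _ i hi h f hf
    have hdom : IsDomain C := hi.isDomain (i : C →+* A)
    obtain ⟨T, _, _, k, hk, hkr⟩ := exists_algHom_range_eq (j.range ⊔ Algebra.adjoin K (s : Set A))
    have hC : i.range = k.range ⊔ Algebra.adjoin K {x} := by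
      rw [h, hkr, sup_assoc, ← Algebra.adjoin_union, Finset.coe_insert, Set.insert_eq,
        Set.union_comm]
    obtain ⟨f₁, hf₁⟩ := exists_comp_eq_of_range_le j k hk (hkr ▸ le_sup_left)
    obtain ⟨f₂, hf₂⟩ := exists_comp_eq_of_range_le k i hi (hC ▸ le_sup_left)
    have hf₂i : Function.Injective f₂ :=
      Function.Injective.of_comp (f := i) (by rw [← AlgHom.coe_comp, hf₂]; exact hk)
    have : f = f₂.comp f₁ := by
      refine AlgHom.ext fun b => hi ?_
      change (i.comp f) b = (i.comp f₂) (f₁ b)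
      rw [hf, hf₂, ← hf₁]
      rfl
    rw [this]
    exact (genericallyOpen_of_range_eq_sup_adjoin k i hk hi hC hf₂).comp hf₂i (ih k hk hkr f₁ hf₁)

theorem genericallyOpen_of_finiteType [CompleteSpace K] [CharZero K] [IsDomain A]
    [Algebra.FiniteType K A] {f : B →ₐ[K] A} (hf : Function.Injective f) :
    GenericallyOpen f := by
  obtain ⟨s, hs⟩ := Algebra.FiniteType.out (R := K) (A := A)
  refine genericallyOpen_of_range_eq_sup_finset f hf s (AlgHom.id K A) (fun _ _ h => h) ?_ f rfl
  rw [hs, sup_top_eq, AlgHom.range_eq_top]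
  exact Function.surjective_id

/-- In a reduced Noetherian ring, a minimal prime is annihilated by an element outside it. -/
theorem exists_mul_eq_zero_of_mem_minimalPrimes {R : Type*} [CommRing R] [IsReduced R]
    [IsNoetherianRing R] {P : Ideal R} (hP : P ∈ minimalPrimes R) :
    ∃ s ∉ P, ∀ x ∈ P, s * x = 0 := by
  classical
  have hfin := minimalPrimes.finite_of_isNoetherianRing R
  have hPp := hP.isPrime
  have hex : ∀ Q ∈ (minimalPrimes R) \ {P}, ∃ x ∈ Q, x ∉ P := by
    rintro Q ⟨hQ, hne⟩
    by_contra! h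
    exact hne ((hP.2 ⟨hQ.isPrime, bot_le⟩ h).antisymm' h)
  choose! x hxQ hxP using hex
  have hfin' : ((minimalPrimes R) \ {P}).Finite := hfin.sdiff
  -- The product lies in every minimal prime other than `P`. Multiplied by an element of `P` it lies
  -- in all of them, hence in the nilradical, which is zero.
  refine ⟨∏ Q ∈ hfin'.toFinset, x Q, ?_, ?_⟩
  · rw [hPp.prod_mem_iff]
    rintro ⟨Q, hQ, hx⟩
    exact hxP Q (hfin'.mem_toFinset.1 hQ) hx
  · intro y hy
    have h0 : sInf (minimalPrimes R) = (⊥ : Ideal R) := by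
      have := Ideal.sInf_minimalPrimes (I := (⊥ : Ideal R))
      rwa [show (⊥ : Ideal R).radical = ⊥ from nilradical_eq_zero R] at this
    rw [← Ideal.mem_bot, ← h0, Submodule.mem_sInf]
    intro Q hQ
    by_cases hQP : Q = P
    · rw [hQP]; exact Ideal.mul_mem_left P _ hy
    · refine Ideal.mul_mem_right _ Q ?_
      exact Ideal.mem_of_dvd Q (Finset.dvd_prod_of_mem x (hfin'.mem_toFinset.2 ⟨hQ, hQP⟩))
        (hxQ Q ⟨hQ, hQP⟩)

/-- Reduction to domains: a minimal prime `Q` of `B` is the contraction of a minimal prime `P` of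
`A`. Away from the zeros of elements annihilating `P` and `Q`, points of `A` and `B` are points of
`A ⧸ P` and `B ⧸ Q`. The hypothesis `hsep` provides a `K`-point in the resulting nonempty Zariski
open set. -/
theorem exists_restrictionOpenAt [CompleteSpace K] [CharZero K] [Nontrivial A]
    [Algebra.FiniteType K A] [Algebra.FiniteType K B]
    (hsep : ∀ a : A, a ≠ 0 → ∃ Φ : A →ₐ[K] K, Φ a ≠ 0)
    {f : B →ₐ[K] A} (hf : Function.Injective f) :
    ∃ Φ₀ : A →ₐ[K] K, RestrictionOpenAt f Φ₀ := by
  have hredA : IsReduced A := by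
    refine ⟨fun a ⟨n, hn⟩ => ?_⟩
    by_contra h0
    obtain ⟨Φ, hΦ⟩ := hsep a h0
    exact pow_ne_zero n hΦ (by rw [← map_pow, hn, map_zero])
  have hredB : IsReduced B := isReduced_of_injective f hf
  have hnoeA : IsNoetherianRing A := Algebra.FiniteType.isNoetherianRing K A
  have hnoeB : IsNoetherianRing B := Algebra.FiniteType.isNoetherianRing K B
  have hntB : Nontrivial B := f.toRingHom.domain_nontrivial
  obtain ⟨Q, hQ⟩ : (minimalPrimes B).Nonempty := by
    obtain ⟨Q⟩ := Ideal.nonempty_minimalPrimes (bot_ne_top (α := Ideal B))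
    exact ⟨Q.1, Q.2⟩
  obtain ⟨P, hP, hPQ⟩ := Ideal.exists_minimalPrimes_comap_eq (I := (⊥ : Ideal A)) (f : B →+* A) Q
    (by rwa [Ideal.comap_bot_of_injective (f : B →+* A) hf])
  have hPp := hP.isPrime
  have hQp := hQ.isPrime
  obtain ⟨s, hsP, hs⟩ := exists_mul_eq_zero_of_mem_minimalPrimes hP
  obtain ⟨t, htQ, ht⟩ := exists_mul_eq_zero_of_mem_minimalPrimes hQ
  let g : (B ⧸ Q) →ₐ[K] (A ⧸ P) := Ideal.quotientMapₐ P f (le_of_eq hPQ.symm)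
  have hg : Function.Injective g := Ideal.quotientMap_injective' (H := le_of_eq hPQ.symm) (le_of_eq hPQ)
  obtain ⟨h, h0, H⟩ := genericallyOpen_of_finiteType hg
  obtain ⟨h', rfl⟩ := Ideal.Quotient.mk_surjective h
  have hne : s * h' * f t ≠ 0 := by
    intro hz
    have : s * h' * f t ∈ P := hz ▸ P.zero_mem
    rcases hPp.mem_or_mem this with h1 | h1
    · rcases hPp.mem_or_mem h1 with h2 | h2
      · exact hsP h2
      · exact h0 (Ideal.Quotient.eq_zero_iff_mem.2 h2)
    · exact htQ (by rw [← hPQ]; exact h1)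
  obtain ⟨Φ₀, hΦ₀⟩ := hsep _ hne
  rw [map_mul, map_mul] at hΦ₀
  have hs0 : Φ₀ s ≠ 0 := left_ne_zero_of_mul (left_ne_zero_of_mul hΦ₀)
  have hkill : ∀ a ∈ P, Φ₀ a = 0 := fun a ha =>
    (mul_eq_zero.1 (by rw [← map_mul, hs a ha, map_zero] : Φ₀ s * Φ₀ a = 0)).resolve_left hs0
  let Ψ₀ : (A ⧸ P) →ₐ[K] K := Ideal.Quotient.liftₐ P Φ₀ hkill
  have hopen := H Ψ₀ (right_ne_zero_of_mul (left_ne_zero_of_mul hΦ₀))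
  refine ⟨Φ₀, fun S hS => ?_⟩
  have hS' := tendsto_comp_nhdsHom (Ideal.Quotient.mkₐ K P) Ψ₀ (show S ∈ _ from hS)
  have h1 := hopen _ hS'
  have hev : ∀ᶠ ψ : B →ₐ[K] K in nhdsHom (Φ₀.comp f), ψ t ≠ 0 :=
    (tendsto_eval_nhdsHom (Φ₀.comp f) t).eventually_ne (right_ne_zero_of_mul hΦ₀)
  have hkillQ : ∀ ψ : B →ₐ[K] K, ψ t ≠ 0 → ∀ b ∈ Q, ψ b = 0 := fun ψ hψ b hb =>
    (mul_eq_zero.1 (by rw [← map_mul, ht b hb, map_zero] : ψ t * ψ b = 0)).resolve_left hψ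
  classical
  -- The default value is harmless, since `ψ t ≠ 0` holds near the base point.
  let ρ : (B →ₐ[K] K) → (B ⧸ Q) →ₐ[K] K := fun ψ =>
    if hψ : ψ t ≠ 0 then Ideal.Quotient.liftₐ Q ψ (hkillQ ψ hψ) else Ψ₀.comp g
  have hρ : ∀ ψ : B →ₐ[K] K, ψ t ≠ 0 → ∀ b, ρ ψ (Ideal.Quotient.mk Q b) = ψ b := by
    intro ψ hψ b
    simp only [ρ, dif_pos hψ]
    exact Ideal.Quotient.lift_mk _ _ _
  have hρt : Tendsto ρ (nhdsHom (Φ₀.comp f)) (nhdsHom (Ψ₀.comp g)) := by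
    refine tendsto_nhdsHom_iff.2 fun b => ?_
    obtain ⟨b, rfl⟩ := Ideal.Quotient.mk_surjective b
    refine (tendsto_eval_nhdsHom (Φ₀.comp f) b).congr' ?_
    filter_upwards [hev] with ψ hψ
    exact (hρ ψ hψ b).symm
  filter_upwards [hev, hρt h1] with ψ hψ ⟨Ψ, hΨS, hΨ⟩
  refine ⟨Ψ.comp (Ideal.Quotient.mkₐ K P), hΨS, AlgHom.ext fun b => ?_⟩
  rw [← hρ ψ hψ b, ← hΨ]
  rfl

end AlgebraicOpenness

/-! ### Regular maps on products of algebraic groups, and openness of orbits. -/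

section AlgebraicPoints

universe u v in
-- With `R` a ring of functions on a set of points, `A` is the coordinate ring of the Zariski
-- closure of that set, and `j` reads its elements as functions.
theorem exists_finiteType_factorization {K : Type u} [Field K] {σ : Type v} [Finite σ] {R : Type*}
    [CommRing R] [Algebra K R] (π : MvPolynomial σ K →ₐ[K] R) :
    ∃ (A : Type (max v u)) (_ : CommRing A) (_ : Algebra K A) (_ : Algebra.FiniteType K A)
      (q : MvPolynomial σ K →ₐ[K] A) (j : A →ₐ[K] R), Function.Surjective q ∧
      Function.Injective j ∧ j.comp q = π :=
  ⟨MvPolynomial σ K ⧸ RingHom.ker π, inferInstance, inferInstance, inferInstance,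
    Ideal.Quotient.mkₐ K _, Ideal.kerLiftAlg π, Ideal.Quotient.mkₐ_surjective _ _,
    Ideal.kerLiftAlg_injective π, rfl⟩

variable {K : Type*} {n : ℕ} {O : Type*}

/-- The matrix entries of the components of a tuple (for `b = true`) and of their inverses
(for `b = false`). -/
def entryFunction [Field K] (L : O → Subgroup (GL (Fin n) K)) (s : O × Bool × Fin n × Fin n)
    (γ : ∀ o, L o) : K :=
  bif s.2.1 then ((γ s.1 : GL (Fin n) K) : Matrix (Fin n) (Fin n) K) s.2.2.1 s.2.2.2
  else (((γ s.1 : GL (Fin n) K)⁻¹ : GL (Fin n) K) : Matrix (Fin n) (Fin n) K) s.2.2.1 s.2.2.2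

/-- The regular functions on a product of algebraic groups of matrices. -/
noncomputable def regularFunctions [Field K] (L : O → Subgroup (GL (Fin n) K)) :
    Subalgebra K ((∀ o, L o) → K) :=
  (MvPolynomial.aeval (R := K) (entryFunction L)).range

theorem aeval_pi_apply [Field K] {σ Γ : Type*} (F : σ → Γ → K) (p : MvPolynomial σ K) (γ : Γ) :
    MvPolynomial.aeval F p γ = MvPolynomial.eval (fun t => F t γ) p := by
  have : (Pi.evalAlgHom K (fun _ : Γ => K) γ).comp (MvPolynomial.aeval F) =
      MvPolynomial.aeval (fun t => F t γ) := by
    ext t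
    simp
  have h := DFunLike.congr_fun this p
  rw [MvPolynomial.aeval_eq_eval] at h
  exact h

/-- A point satisfying all polynomial relations between the entry functions comes from a tuple of
group elements. -/
theorem exists_entryFunction_eq [Field K] (L : O → Subgroup (GL (Fin n) K))
    (hL : ∀ o, IsAlgebraicSubgroup (L o)) (x : O × Bool × Fin n × Fin n → K)
    (hx : ∀ p : MvPolynomial (O × Bool × Fin n × Fin n) K,
      (∀ γ, MvPolynomial.eval (fun s => entryFunction L s γ) p = 0) → MvPolynomial.eval x p = 0) :
    ∃ γ : ∀ o, L o, ∀ s, entryFunction L s γ = x s := by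
  classical
  let M : Bool → O → Matrix (Fin n) (Fin n) K := fun b o => Matrix.of fun i j => x (o, b, i, j)
  have hprod : ∀ (b : Bool) (o : O), M b o * M (!b) o = 1 := by
    intro b o
    ext i j
    have := hx (∑ k, MvPolynomial.X (o, b, i, k) * MvPolynomial.X (o, !b, k, j)
      - MvPolynomial.C ((1 : Matrix (Fin n) (Fin n) K) i j)) (fun γ => by
        rw [map_sub, map_sum, MvPolynomial.eval_C, sub_eq_zero]
        simp only [map_mul, MvPolynomial.eval_X]
        cases b
        · simp only [entryFunction, Bool.not_false, cond_true, cond_false]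
          rw [← Matrix.mul_apply, Units.inv_mul]
        · simp only [entryFunction, Bool.not_true, cond_true, cond_false]
          rw [← Matrix.mul_apply, Units.mul_inv])
    rw [map_sub, map_sum, MvPolynomial.eval_C, sub_eq_zero] at this
    simp only [map_mul, MvPolynomial.eval_X] at this
    rw [Matrix.mul_apply, ← this]
    rfl
  let g : O → GL (Fin n) K := fun o => ⟨M true o, M false o, hprod true o, hprod false o⟩
  have hg : ∀ o, g o ∈ L o := by
    intro o
    obtain ⟨S, hS⟩ := hL o
    rw [hS]
    intro p hp
    have := hx (MvPolynomial.rename (fun ij : Fin n × Fin n => (o, true, ij.1, ij.2)) p) (fun γ => by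
      rw [MvPolynomial.eval_rename]
      exact (hS _).1 (γ o).2 p hp)
    rw [MvPolynomial.eval_rename] at this
    exact this
  refine ⟨fun o => ⟨g o, hg o⟩, ?_⟩
  rintro ⟨o, b, i, j⟩
  cases b <;> rfl

/-- The unit group carries the topology induced by `g ↦ (g, g⁻¹)`, so the entries of `g` and of its
inverse together control convergence. -/
theorem comap_entryFunction_le_nhds [NontriviallyNormedField K] (L : O → Subgroup (GL (Fin n) K))
    (γ₀ : ∀ o, L o) :
    comap (fun γ s => entryFunction L s γ) (𝓝 fun s => entryFunction L s γ₀) ≤ 𝓝 γ₀ := by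
  set l := comap (fun γ s => entryFunction L s γ) (𝓝 fun s => entryFunction L s γ₀) with hl
  have h0 : ∀ s, Tendsto (fun γ => entryFunction L s γ) l (𝓝 (entryFunction L s γ₀)) :=
    tendsto_pi_nhds.1 tendsto_comap
  change Tendsto id l (𝓝 γ₀)
  refine tendsto_pi_nhds.2 fun o => tendsto_subtype_rng.2 ?_
  rw [Units.isInducing_embedProduct.tendsto_nhds_iff]
  refine Tendsto.prodMk_nhds ?_ ?_
  · exact tendsto_pi_nhds.2 fun i => tendsto_pi_nhds.2 fun j => h0 (o, true, i, j)
  · refine (MulOpposite.continuous_op.tendsto _).comp ?_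
    exact tendsto_pi_nhds.2 fun i => tendsto_pi_nhds.2 fun j => h0 (o, false, i, j)

/-- A map given by regular functions on a product of algebraic groups maps the neighbourhoods of
a suitable point onto neighbourhoods within the Zariski closure of its range. -/
theorem exists_open_point [NontriviallyNormedField K] [CompleteSpace K] [CharZero K] [Finite O]
    (L : O → Subgroup (GL (Fin n) K)) (hL : ∀ o, IsAlgebraicSubgroup (L o))
    {σ : Type*} [Finite σ] (F : σ → (∀ o, L o) → K) (hF : ∀ t, F t ∈ regularFunctions L) :
    ∃ γ₀ : ∀ o, L o, ∀ U ∈ 𝓝 γ₀, ∀ᶠ z in 𝓝 (fun t => F t γ₀),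
      (∀ p : MvPolynomial σ K, (∀ γ, MvPolynomial.eval (fun t => F t γ) p = 0) →
        MvPolynomial.eval z p = 0) → ∃ γ ∈ U, ∀ t, F t γ = z t := by
  classical
  -- `A` is the coordinate ring of the product of groups, `B` that of the Zariski closure of the
  -- image of `F`, and `f : B → A` below is the injective comorphism.
  obtain ⟨A, _, _, _, q, j, hq, hj, hjq⟩ :=
    exists_finiteType_factorization (MvPolynomial.aeval (R := K) (entryFunction L))
  obtain ⟨B, _, _, _, q', j', hq', hj', hjq'⟩ :=
    exists_finiteType_factorization (MvPolynomial.aeval (R := K) F)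
  have hjr : j.range = regularFunctions L := by
    rw [regularFunctions, ← hjq]
    refine le_antisymm ?_ ?_
    · rintro _ ⟨a, rfl⟩
      obtain ⟨p, rfl⟩ := hq a
      exact ⟨p, rfl⟩
    · rintro _ ⟨p, rfl⟩
      exact ⟨q p, rfl⟩
  obtain ⟨f, hf⟩ : ∃ f : B →ₐ[K] A, j.comp f = j' := by
    refine exists_comp_eq_of_range_le j' j hj ?_
    rintro _ ⟨b, rfl⟩
    obtain ⟨p, rfl⟩ := hq' b
    have : j' (q' p) = MvPolynomial.aeval F p := DFunLike.congr_fun hjq' p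
    rw [hjr]
    change j' (q' p) ∈ _
    rw [this]
    have h2 : (MvPolynomial.aeval (R := K) F).range ≤ regularFunctions L := by
      rw [← Algebra.adjoin_range_eq_range_aeval]
      exact Algebra.adjoin_le (by rintro _ ⟨t, rfl⟩; exact hF t)
    exact h2 ⟨p, rfl⟩
  have hfinj : Function.Injective f :=
    Function.Injective.of_comp (f := j) (by rw [← AlgHom.coe_comp, hf]; exact hj')
  have hjq_apply : ∀ p γ, j (q p) γ = MvPolynomial.eval (fun s => entryFunction L s γ) p := by
    intro p γ
    rw [← aeval_pi_apply, ← hjq]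
    rfl
  have hjq'_apply : ∀ p γ, j (f (q' p)) γ = MvPolynomial.eval (fun t => F t γ) p := by
    intro p γ
    rw [← aeval_pi_apply, ← hjq', ← hf]
    rfl
  have hnt : Nontrivial A := by
    refine ⟨1, 0, fun h => ?_⟩
    have := congrFun (congrArg j h) (fun _ => 1)
    rw [map_one, map_zero] at this
    exact one_ne_zero this
  obtain ⟨Φ₀, hΦ₀⟩ := exists_restrictionOpenAt (K := K) (A := A) (B := B) (fun a ha => by
    have : j a ≠ 0 := by rwa [Ne, map_eq_zero_iff j hj]
    obtain ⟨γ, hγ⟩ := Function.ne_iff.1 this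
    exact ⟨(Pi.evalAlgHom K (fun _ => K) γ).comp j, hγ⟩) hfinj
  -- Algebraicity of the groups enters here: every homomorphism `A → K` is evaluation at an actual
  -- tuple of group elements.
  have hpt : ∀ Φ : A →ₐ[K] K, ∃ γ, ∀ p, Φ (q p) = j (q p) γ := by
    intro Φ
    have hΦ : ∀ p, Φ (q p) = MvPolynomial.eval (fun s => Φ (q (MvPolynomial.X s))) p := by
      intro p
      have : Φ.comp q = MvPolynomial.aeval (fun s => Φ (q (MvPolynomial.X s))) := by
        ext s
        simp
      have h := DFunLike.congr_fun this p
      rw [MvPolynomial.aeval_eq_eval] at h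
      exact h
    obtain ⟨γ, hγ⟩ := exists_entryFunction_eq L hL (fun s => Φ (q (MvPolynomial.X s)))
      (fun p hp => by
        rw [← hΦ]
        have : q p = 0 := hj (by rw [map_zero]; funext γ; rw [hjq_apply, hp]; rfl)
        rw [this, map_zero])
    refine ⟨γ, fun p => ?_⟩
    rw [hΦ, hjq_apply]
    simp only [hγ]
  obtain ⟨γ₀, hγ₀⟩ := hpt Φ₀
  have hent : ∀ s γ, j (q (MvPolynomial.X s)) γ = entryFunction L s γ := by
    intro s γ
    rw [hjq_apply, MvPolynomial.eval_X]
  have hbase : ∀ p, (Φ₀.comp f) (q' p) = MvPolynomial.eval (fun t => F t γ₀) p := by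
    intro p
    obtain ⟨p', hp'⟩ := hq (f (q' p))
    change Φ₀ (f (q' p)) = _
    rw [← hp', hγ₀, hp', hjq'_apply]
  refine ⟨γ₀, fun U hU => ?_⟩
  have hS : {Φ : A →ₐ[K] K | ∃ γ ∈ U, ∀ p, Φ (q p) = j (q p) γ} ∈ nhdsHom Φ₀ := by
    obtain ⟨W, hW, hWU⟩ := mem_comap.1 (comap_entryFunction_le_nhds L γ₀ hU)
    have ht : Tendsto (fun (Φ : A →ₐ[K] K) s => Φ (q (MvPolynomial.X s))) (nhdsHom Φ₀)
        (𝓝 fun s => entryFunction L s γ₀) := by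
      refine tendsto_pi_nhds.2 fun s => ?_
      rw [← hent, ← hγ₀]
      exact tendsto_eval_nhdsHom Φ₀ _
    filter_upwards [ht hW] with Φ hΦ
    obtain ⟨γ, hγ⟩ := hpt Φ
    refine ⟨γ, hWU ?_, hγ⟩
    change (fun s => entryFunction L s γ) ∈ W
    have heq : (fun s => entryFunction L s γ) = fun s => Φ (q (MvPolynomial.X s)) := by
      funext s
      rw [hγ, hent]
    rw [heq]
    exact hΦ
  let V : Set (σ → K) := {z | ∀ p : MvPolynomial σ K,
    (∀ γ, MvPolynomial.eval (fun t => F t γ) p = 0) → MvPolynomial.eval z p = 0}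
  have hker : ∀ z ∈ V, RingHom.ker q'.toRingHom ≤
      RingHom.ker (MvPolynomial.aeval (R := K) z).toRingHom := by
    intro z hz p hp
    change MvPolynomial.aeval z p = 0
    rw [MvPolynomial.aeval_eq_eval]
    refine hz p fun γ => ?_
    have h0 : q' p = 0 := hp
    rw [← hjq'_apply, h0, map_zero, map_zero]
    rfl
  let ρ : (σ → K) → B →ₐ[K] K := fun z =>
    if hz : z ∈ V then AlgHom.liftOfSurjective q' hq' (MvPolynomial.aeval z) (hker z hz)
    else Φ₀.comp f
  have hρ : ∀ z ∈ V, ∀ p, ρ z (q' p) = MvPolynomial.eval z p := by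
    intro z hz p
    simp only [ρ, dif_pos hz]
    rw [AlgHom.liftOfSurjective_apply, MvPolynomial.aeval_eq_eval]
  have hρt : Tendsto ρ (𝓝 (fun t => F t γ₀) ⊓ 𝓟 V) (nhdsHom (Φ₀.comp f)) := by
    refine tendsto_nhdsHom_iff.2 fun b => ?_
    obtain ⟨p, rfl⟩ := hq' b
    rw [hbase]
    have hc : Tendsto (fun z : σ → K => MvPolynomial.eval z p) (𝓝 (fun t => F t γ₀) ⊓ 𝓟 V)
        (𝓝 (MvPolynomial.eval (fun t => F t γ₀) p)) :=
      ((MvPolynomial.continuous_eval p).tendsto _).mono_left inf_le_left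
    refine hc.congr' ?_
    filter_upwards [mem_inf_of_right (mem_principal_self V)] with z hz
    exact (hρ z hz p).symm
  have hfin := hρt.eventually (hΦ₀ _ hS)
  rw [eventually_inf_principal] at hfin
  filter_upwards [hfin] with z hz hzV
  obtain ⟨Φ, ⟨γ, hγU, hγ⟩, hΦ⟩ := hz hzV
  refine ⟨γ, hγU, fun t => ?_⟩
  have h1 := hρ z hzV (MvPolynomial.X t)
  rw [MvPolynomial.eval_X, ← hΦ] at h1
  rw [← h1]
  obtain ⟨p', hp'⟩ := hq (f (q' (MvPolynomial.X t)))
  change _ = Φ (f (q' _))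
  rw [← hp', hγ, hp', hjq'_apply, MvPolynomial.eval_X]

/-- The matrix entries of a tuple of matrices. -/
def tupleCoords [Field K] {m : ℕ} (a : Fin m → GL (Fin n) K) (t : Fin m × Fin n × Fin n) : K :=
  (a t.1 : Matrix (Fin n) (Fin n) K) t.2.1 t.2.2

/-- The orbit of a tuple under left multiplication by `G` and right multiplication of each
component by elements of `H`. -/
def tupleOrbit [Field K] {m : ℕ} (G H : Subgroup (GL (Fin n) K)) (b : Fin m → GL (Fin n) K) :
    Set (Fin m → GL (Fin n) K) :=
  {w | ∃ g ∈ G, ∃ h : Fin m → GL (Fin n) K, (∀ k, h k ∈ H) ∧ w = fun k => g * b k * h k}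

/-- The polynomials vanishing on an orbit of tuples. -/
def orbitIdeal [Field K] {m : ℕ} (G H : Subgroup (GL (Fin n) K)) (b : Fin m → GL (Fin n) K) :
    Submodule K (MvPolynomial (Fin m × Fin n × Fin n) K) where
  carrier := {p | ∀ w ∈ tupleOrbit G H b, MvPolynomial.eval (tupleCoords w) p = 0}
  zero_mem' := fun _ _ => map_zero _
  add_mem' := fun hp hq w hw => by rw [map_add, hp w hw, hq w hw, add_zero]
  smul_mem' := fun c p hp w hw => by rw [MvPolynomial.smul_eval, hp w hw, mul_zero]

theorem mem_orbitIdeal_iff [Field K] {m : ℕ} {G H : Subgroup (GL (Fin n) K)}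
    {b : Fin m → GL (Fin n) K} {p : MvPolynomial (Fin m × Fin n × Fin n) K} :
    p ∈ orbitIdeal G H b ↔ ∀ w ∈ tupleOrbit G H b, MvPolynomial.eval (tupleCoords w) p = 0 :=
  Iff.rfl

theorem tupleOrbit_mul_mul_mem [Field K] {m : ℕ} {G H : Subgroup (GL (Fin n) K)}
    {b w : Fin m → GL (Fin n) K} (hw : w ∈ tupleOrbit G H b) {g : GL (Fin n) K} (hg : g ∈ G)
    {h : Fin m → GL (Fin n) K} (hh : ∀ k, h k ∈ H) :
    (fun k => g * w k * h k) ∈ tupleOrbit G H b := by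
  obtain ⟨g', hg', h', hh', rfl⟩ := hw
  exact ⟨g * g', G.mul_mem hg hg', fun k => h' k * h k, fun k => H.mul_mem (hh' k) (hh k),
    by funext k; simp only [mul_assoc]⟩

/-- Translations are linear in the matrix entries, so they act on polynomials; this lets the
vanishing conditions be moved along an orbit. -/
theorem exists_eval_translate_eq [Field K] {m : ℕ} (g : GL (Fin n) K) (h : Fin m → GL (Fin n) K)
    (p : MvPolynomial (Fin m × Fin n × Fin n) K) :
    ∃ p' : MvPolynomial (Fin m × Fin n × Fin n) K, ∀ w : Fin m → GL (Fin n) K,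
      MvPolynomial.eval (tupleCoords w) p' =
        MvPolynomial.eval (tupleCoords fun k => g * w k * h k) p := by
  refine ⟨MvPolynomial.bind₁ (fun t => ∑ j, (∑ i, MvPolynomial.C
    ((g : Matrix (Fin n) (Fin n) K) t.2.1 i) * MvPolynomial.X (t.1, i, j)) *
      MvPolynomial.C ((h t.1 : Matrix (Fin n) (Fin n) K) j t.2.2)) p, fun w => ?_⟩
  rw [← MvPolynomial.aeval_eq_eval, ← MvPolynomial.aeval_eq_eval]
  rw [MvPolynomial.aeval_bind₁]
  congr 2
  funext t
  simp [tupleCoords, Matrix.mul_apply]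

theorem continuous_tupleCoords [NontriviallyNormedField K] {m : ℕ} :
    Continuous (tupleCoords : (Fin m → GL (Fin n) K) → _) := by
  refine continuous_pi fun t => ?_
  have h : Continuous fun a : Fin m → GL (Fin n) K => (a t.1 : Matrix (Fin n) (Fin n) K) :=
    Units.continuous_val.comp (continuous_apply t.1)
  exact h.matrix_elem _ _

/-- Orbits of tuples are open in their Zariski closure, and the orbit map is open. -/
theorem eventually_mem_tupleOrbit [NontriviallyNormedField K] [CompleteSpace K] [CharZero K]
    {G H : Subgroup (GL (Fin n) K)} (hG : IsAlgebraicSubgroup G) (hH : IsAlgebraicSubgroup H)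
    {m : ℕ} (b : Fin m → GL (Fin n) K) {U : Set (GL (Fin n) K)} (hU : U ∈ 𝓝 1) :
    ∀ᶠ z in 𝓝 b, (∀ p ∈ orbitIdeal G H b, MvPolynomial.eval (tupleCoords z) p = 0) →
      ∃ c ∈ U, c ∈ G ∧ ∃ h : Fin m → GL (Fin n) K, (∀ k, h k ∈ H) ∧
        z = fun k => c * b k * h k := by
  -- The index `none` carries the left factor in `G`, and `some k` the right factor in `H` of the
  -- `k`-th component.
  let L : Option (Fin m) → Subgroup (GL (Fin n) K) := fun o => o.elim G fun _ => H
  have hL : ∀ o, IsAlgebraicSubgroup (L o) := by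
    rintro (_ | k)
    exacts [hG, hH]
  let P : (∀ o, L o) → Fin m → GL (Fin n) K := fun γ k => γ none * b k * γ (some k)
  have hP : ∀ γ, P γ ∈ tupleOrbit G H b := fun γ =>
    ⟨γ none, (γ none).2, fun k => γ (some k), fun k => (γ (some k)).2, rfl⟩
  have hPsurj : ∀ w ∈ tupleOrbit G H b, ∃ γ, P γ = w := by
    rintro _ ⟨g, hg, h, hh, rfl⟩
    refine ⟨fun o => match o with
      | none => ⟨g, hg⟩
      | some k => ⟨h k, hh k⟩, rfl⟩
  have hF : ∀ t, (fun γ => tupleCoords (P γ) t) ∈ regularFunctions L := by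
    rintro ⟨k, i, j⟩
    have : (fun γ => tupleCoords (P γ) (k, i, j)) = ∑ s, (∑ r, entryFunction L (none, true, i, r) *
        algebraMap K _ ((b k : Matrix (Fin n) (Fin n) K) r s)) *
          entryFunction L (some k, true, s, j) := by
      funext γ
      simp only [tupleCoords, P, Units.val_mul, Matrix.mul_apply, Finset.sum_apply, Pi.mul_apply]
      rfl
    rw [this]
    have hent : ∀ s, entryFunction L s ∈ regularFunctions L := fun s =>
      ⟨MvPolynomial.X s, MvPolynomial.aeval_X _ _⟩
    exact Subalgebra.sum_mem _ fun s _ => Subalgebra.mul_mem _ (Subalgebra.sum_mem _ fun r _ =>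
      Subalgebra.mul_mem _ (hent _) (Subalgebra.algebraMap_mem _ _)) (hent _)
  obtain ⟨γ₀, hγ₀⟩ := exists_open_point L hL (fun t γ => tupleCoords (P γ) t) hF
  set g₀ : GL (Fin n) K := (γ₀ none).1 with hg₀
  have hcont : Continuous fun γ : ∀ o, L o => g₀⁻¹ * (γ none : GL (Fin n) K) :=
    continuous_const.mul (continuous_subtype_val.comp (continuous_apply none))
  have hU' : {γ : ∀ o, L o | g₀⁻¹ * (γ none : GL (Fin n) K) ∈ U} ∈ 𝓝 γ₀ := by
    refine hcont.continuousAt.preimage_mem_nhds ?_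
    rwa [← hg₀, inv_mul_cancel]
  have hev := hγ₀ _ hU'
  -- Openness is known only at the point `γ₀`. Translation by its components carries `b` to the
  -- image of `γ₀`, and undoing it transfers openness to `b`.
  have hτ : Continuous fun z : Fin m → GL (Fin n) K =>
      tupleCoords fun k => g₀ * z k * (γ₀ (some k) : GL (Fin n) K) :=
    continuous_tupleCoords.comp (continuous_pi fun k =>
      (continuous_const.mul (continuous_apply k)).mul continuous_const)
  filter_upwards [(hτ.tendsto b).eventually hev] with z hz hzb
  obtain ⟨γ, hγU, hγ⟩ := hz fun p hp => by
    obtain ⟨p', hp'⟩ := exists_eval_translate_eq g₀ (fun k => (γ₀ (some k) : GL (Fin n) K)) p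
    rw [← hp']
    refine hzb p' fun w hw => ?_
    rw [hp']
    obtain ⟨γ, hγ⟩ := hPsurj _ (tupleOrbit_mul_mul_mem hw (γ₀ none).2 fun k => (γ₀ (some k)).2)
    rw [← hγ]
    exact hp γ
  refine ⟨g₀⁻¹ * γ none, hγU, G.mul_mem (G.inv_mem (γ₀ none).2) (γ none).2,
    fun k => γ (some k) * (γ₀ (some k) : GL (Fin n) K)⁻¹,
    fun k => H.mul_mem (γ (some k)).2 (H.inv_mem (γ₀ (some k)).2), ?_⟩
  funext k
  have hk : (γ none : GL (Fin n) K) * b k * γ (some k) = g₀ * z k * (γ₀ (some k) : GL (Fin n) K) := by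
    refine Units.ext (Matrix.ext fun i j => ?_)
    exact hγ (k, i, j)
  calc z k = g₀⁻¹ * (g₀ * z k * (γ₀ (some k) : GL (Fin n) K)) * (γ₀ (some k) : GL (Fin n) K)⁻¹ := by
        group
    _ = _ := by rw [← hk]; group

end AlgebraicPoints

/-! ### Dimensions of vanishing spaces as semicontinuous invariants of orbits. -/

section OrbitDimension

/-- Among the intersections of finitely many kernels there is a minimal one, and adding a further
kernel cannot shrink it. -/
theorem exists_finset_iInf_ker_le {K V ι : Type*} [Field K] [AddCommGroup V] [Module K V]
    [FiniteDimensional K V] (φ : ι → V →ₗ[K] K) :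
    ∃ s : Finset ι, ∀ v, (∀ i ∈ s, φ i v = 0) → ∀ i, φ i v = 0 := by
  classical
  obtain ⟨_, ⟨s, rfl⟩, hs⟩ := WellFounded.has_min
    (wellFounded_lt : WellFounded ((· < ·) : Submodule K V → Submodule K V → Prop))
    (Set.range fun s : Finset ι => ⨅ i ∈ s, LinearMap.ker (φ i)) ⟨_, ∅, rfl⟩
  refine ⟨s, fun v hv i => ?_⟩
  have h1 := hs _ ⟨insert i s, rfl⟩
  have h2 : (⨅ j ∈ insert i s, LinearMap.ker (φ j)) ≤ ⨅ j ∈ s, LinearMap.ker (φ j) :=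
    iInf_mono fun j => iInf_mono' fun h => ⟨Finset.mem_insert_of_mem h, le_rfl⟩
  have h3 := (eq_of_le_of_not_lt h2 h1).ge
  have h4 : v ∈ ⨅ j ∈ s, LinearMap.ker (φ j) := by
    simp only [Submodule.mem_iInf, LinearMap.mem_ker]
    exact hv
  have h5 := h3 h4
  simp only [Submodule.mem_iInf, LinearMap.mem_ker] at h5
  exact h5 i (Finset.mem_insert_self _ _)

/-- The dimension of the common kernel of a continuous family of functionals is upper
semicontinuous. -/
theorem eventually_finrank_le_of_continuous {K V ι T : Type*} [NontriviallyNormedField K]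
    [CompleteSpace K] [AddCommGroup V] [Module K V] [FiniteDimensional K V] [TopologicalSpace T]
    (φ : T → ι → V →ₗ[K] K) (hφ : ∀ i v, Continuous fun t => φ t i v) (N : T → Submodule K V)
    (hN : ∀ t v, v ∈ N t ↔ ∀ i, φ t i v = 0) (t₀ : T) :
    ∀ᶠ t in 𝓝 t₀, Module.finrank K (N t) ≤ Module.finrank K (N t₀) := by
  obtain ⟨s, hs⟩ := exists_finset_iInf_ker_le (φ t₀)
  -- Finitely many functionals are jointly injective on the complement `C` at `t₀`. Linear
  -- independence is an open condition, so for `t` near `t₀` the space `N t` still meets `C`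
  -- trivially.
  obtain ⟨C, hC⟩ := (N t₀).exists_isCompl
  let v := Module.finBasis K C
  let f : T → Fin (Module.finrank K C) → (s → K) := fun t j i => φ t i (v j)
  have hfc : Continuous f :=
    continuous_pi fun j => continuous_pi fun i => hφ i (v j)
  let e : T → C →ₗ[K] (s → K) := fun t => LinearMap.pi fun i => (φ t i).comp C.subtype
  have hef : ∀ t, f t = e t ∘ v := fun t => rfl
  have hli : LinearIndependent K (f t₀) := by
    rw [hef]
    refine v.linearIndependent.map' _ (LinearMap.ker_eq_bot'.2 fun c hc => ?_)
    have h1 : (c : V) ∈ N t₀ := by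
      rw [hN]
      exact hs _ fun i hi => congrFun hc ⟨i, hi⟩
    have h2 : (c : V) ∈ (⊥ : Submodule K V) := hC.inf_eq_bot ▸ ⟨h1, c.2⟩
    exact Subtype.ext h2
  filter_upwards [hfc.continuousAt.eventually hli.eventually] with t ht
  have hinj : Function.Injective (e t) := by
    rw [← LinearMap.ker_eq_bot, LinearMap.ker_eq_bot']
    intro c hc
    have h1 := v.sum_repr c
    rw [← h1, map_sum] at hc
    simp only [map_smul] at hc
    have h2 := Fintype.linearIndependent_iff.1 ht (fun j => v.repr c j) hc
    rw [← h1]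
    exact Finset.sum_eq_zero fun j _ => by rw [h2 j, zero_smul]
  have hdisj : N t ⊓ C = ⊥ := by
    rw [eq_bot_iff]
    rintro c ⟨hc1, hc2⟩
    have : (⟨c, hc2⟩ : C) = 0 := hinj (by
      rw [map_zero]
      funext i
      exact (hN t c).1 hc1 i)
    exact congrArg Subtype.val this
  have h1 := Submodule.finrank_add_finrank_le_of_disjoint (disjoint_iff.2 hdisj)
  have h2 := Submodule.finrank_add_eq_of_isCompl hC
  omega

variable {K : Type*} {n m : ℕ}

/-- The dimension of the space of polynomials of degree at most `d` vanishing on an orbit. -/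
noncomputable def orbitDim [Field K] (G H : Subgroup (GL (Fin n) K)) (d : ℕ)
    (b : Fin m → GL (Fin n) K) : ℕ :=
  Module.finrank K ((orbitIdeal G H b).submoduleOf
    (MvPolynomial.restrictTotalDegree (Fin m × Fin n × Fin n) K d))

/-- Each choice of group elements imposes one linear condition on polynomials of degree at most `d`,
and this condition depends continuously on the tuple. -/
theorem eventually_orbitDim_le [NontriviallyNormedField K] [CompleteSpace K]
    (G H : Subgroup (GL (Fin n) K)) (d : ℕ) (b : Fin m → GL (Fin n) K) :
    ∀ᶠ a in 𝓝 b, orbitDim G H d a ≤ orbitDim G H d b := by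
  let φ : (Fin m → GL (Fin n) K) → G × (Fin m → H) →
      MvPolynomial.restrictTotalDegree (Fin m × Fin n × Fin n) K d →ₗ[K] K := fun a γ =>
    (MvPolynomial.aeval (R := K) (tupleCoords fun k => (γ.1 : GL (Fin n) K) * a k
      * (γ.2 k : GL (Fin n) K))).toLinearMap.comp (Submodule.subtype _)
  have hφ : ∀ a γ p, φ a γ p = MvPolynomial.eval (tupleCoords fun k => (γ.1 : GL (Fin n) K) * a k
      * (γ.2 k : GL (Fin n) K)) (p : MvPolynomial (Fin m × Fin n × Fin n) K) := by
    intro a γ p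
    rw [← MvPolynomial.aeval_eq_eval]
    rfl
  refine eventually_finrank_le_of_continuous φ (fun γ p => ?_) (fun a => (orbitIdeal G H a).submoduleOf
    (MvPolynomial.restrictTotalDegree (Fin m × Fin n × Fin n) K d)) (fun a p => ?_) b
  · simp only [hφ]
    exact (MvPolynomial.continuous_eval _).comp (continuous_tupleCoords.comp
      (continuous_pi fun k => (continuous_const.mul (continuous_apply k)).mul continuous_const))
  · simp only [hφ]
    constructor
    · exact fun hp γ => hp _ ⟨γ.1, γ.1.2, fun k => γ.2 k, fun k => (γ.2 k).2, rfl⟩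
    · rintro hp _ ⟨g, hg, h, hh, rfl⟩
      exact hp ⟨⟨g, hg⟩, fun k => ⟨h k, hh k⟩⟩

theorem orbitIdeal_le_of_mem_closure [NontriviallyNormedField K]
    {G H : Subgroup (GL (Fin n) K)} {a b : Fin m → GL (Fin n) K}
    (hb : b ∈ closure (tupleOrbit G H a)) : orbitIdeal G H a ≤ orbitIdeal G H b := by
  rintro p hp _ ⟨g, hg, h, hh, rfl⟩
  have hc : Continuous fun z : Fin m → GL (Fin n) K =>
      MvPolynomial.eval (tupleCoords fun k => g * z k * h k) p :=
    (MvPolynomial.continuous_eval _).comp (continuous_tupleCoords.comp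
      (continuous_pi fun k => (continuous_const.mul (continuous_apply k)).mul continuous_const))
  have := closure_minimal (s := tupleOrbit G H a)
    (t := {z | MvPolynomial.eval (tupleCoords fun k => g * z k * h k) p = 0})
    (fun z hz => hp _ (tupleOrbit_mul_mul_mem hz hg hh)) (isClosed_eq hc continuous_const)
  exact this hb

/-- A given polynomial is tested in the finite-dimensional piece cut out by its own total degree,
where inclusion and equal dimension force equality. -/
theorem orbitIdeal_eq_of_le_of_orbitDim_eq [Field K] {G H : Subgroup (GL (Fin n) K)}
    {a b : Fin m → GL (Fin n) K} (hle : orbitIdeal G H a ≤ orbitIdeal G H b)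
    (hd : ∀ d, orbitDim G H d a = orbitDim G H d b) : orbitIdeal G H a = orbitIdeal G H b := by
  refine le_antisymm hle fun p hp => ?_
  have h1 := Submodule.eq_of_le_of_finrank_eq (Submodule.comap_mono
    (f := (MvPolynomial.restrictTotalDegree (Fin m × Fin n × Fin n) K p.totalDegree).subtype) hle)
    (hd p.totalDegree)
  have h2 : (⟨p, (MvPolynomial.mem_restrictTotalDegree _ _ _).2 le_rfl⟩ :
      MvPolynomial.restrictTotalDegree (Fin m × Fin n × Fin n) K p.totalDegree) ∈
      (orbitIdeal G H b).comap (Submodule.subtype _) := hp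
  rw [← h1] at h2
  exact h2

theorem tupleOrbit_eq_of_mem [Field K] {G H : Subgroup (GL (Fin n) K)}
    {a b : Fin m → GL (Fin n) K} (hb : b ∈ tupleOrbit G H a) :
    tupleOrbit G H b = tupleOrbit G H a := by
  have key : ∀ {a b : Fin m → GL (Fin n) K}, b ∈ tupleOrbit G H a →
      tupleOrbit G H b ⊆ tupleOrbit G H a := by
    rintro a b hb _ ⟨g, hg, h, hh, rfl⟩
    exact tupleOrbit_mul_mul_mem hb hg hh
  refine (key hb).antisymm (key ?_)
  obtain ⟨g, hg, h, hh, rfl⟩ := hb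
  refine ⟨g⁻¹, G.inv_mem hg, fun k => (h k)⁻¹, fun k => H.inv_mem (hh k), ?_⟩
  funext k
  group

/-! ### Transfer from tuples of matrices to tuples of cosets. -/

variable [NontriviallyNormedField K] {G : Subgroup (GL (Fin n) K)} {H : Subgroup G}

theorem coe_mem_tupleOrbit_of_mk_eq {a b : Fin m → G} {g : G}
    (h : ∀ k, (b k : G ⧸ H) = g • (a k : G ⧸ H)) :
    (fun k => (b k : GL (Fin n) K)) ∈
      tupleOrbit G (H.map G.subtype) (fun k => (a k : GL (Fin n) K)) := by
  have h' : ∀ k, (g * a k)⁻¹ * b k ∈ H := fun k => by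
    rw [← QuotientGroup.eq]
    exact (h k).symm
  refine ⟨g, g.2, fun k => ((g * a k)⁻¹ * b k : G), fun k => ⟨_, h' k, rfl⟩, ?_⟩
  funext k
  simp [mul_assoc]

/-- The dimension of the space of polynomials of degree at most `d` vanishing on the preimage of
the orbit of a tuple of cosets. -/
noncomputable def cosetOrbitDim (d : ℕ) (x : Fin m → G ⧸ H) : ℕ :=
  orbitDim G (H.map G.subtype) d fun k => ((x k).out : GL (Fin n) K)

/-- Independence of representatives and invariance under `G` at once: all these tuples of
representatives lie in one orbit. -/
theorem cosetOrbitDim_eq_of_mk_eq (d : ℕ) (x : Fin m → G ⧸ H) (b : Fin m → G) (g : G)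
    (h : ∀ k, (b k : G ⧸ H) = g • x k) :
    cosetOrbitDim d x = orbitDim G (H.map G.subtype) d fun k => (b k : GL (Fin n) K) := by
  have := tupleOrbit_eq_of_mem (coe_mem_tupleOrbit_of_mk_eq (a := fun k => (x k).out) (b := b)
    (g := g) (fun k => by rw [h, QuotientGroup.out_eq']))
  have h2 : orbitIdeal G (H.map G.subtype) (fun k => (b k : GL (Fin n) K)) =
      orbitIdeal G (H.map G.subtype) (fun k => ((x k).out : GL (Fin n) K)) :=
    Submodule.ext fun p => by rw [mem_orbitIdeal_iff, mem_orbitIdeal_iff, this]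
  rw [cosetOrbitDim, orbitDim, orbitDim, h2]

theorem cosetOrbitDim_smul (d : ℕ) (x : Fin m → G ⧸ H) (g : G) :
    cosetOrbitDim d (fun k => g • x k) = cosetOrbitDim d x := by
  rw [cosetOrbitDim_eq_of_mk_eq d x (fun k => (g • x k).out) g fun k => QuotientGroup.out_eq' _]
  rfl

/-- The quotient map is open, so cosets near those of `b` have representatives near `b`. -/
theorem image_mk_mem_nhds {V : Set (Fin m → GL (Fin n) K)} {b : Fin m → G}
    (hV : V ∈ 𝓝 fun k => (b k : GL (Fin n) K)) :
    {x : Fin m → G ⧸ H | ∃ v : Fin m → G, (fun k => (v k : GL (Fin n) K)) ∈ V ∧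
      ∀ k, (v k : G ⧸ H) = x k} ∈ 𝓝 fun k => (b k : G ⧸ H) := by
  have hc : Continuous fun (v : Fin m → G) k => (v k : GL (Fin n) K) :=
    continuous_pi fun k => continuous_subtype_val.comp (continuous_apply k)
  have h1 : (fun (v : Fin m → G) k => (v k : GL (Fin n) K)) ⁻¹' V ∈ 𝓝 b :=
    hc.continuousAt.preimage_mem_nhds hV
  have hopen : IsOpenMap (Pi.map fun (_ : Fin m) (g : G) => (g : G ⧸ H)) :=
    IsOpenMap.piMap (fun _ => QuotientGroup.isOpenMap_coe) (by simp)
  refine mem_of_superset (hopen.image_mem_nhds h1) ?_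
  rintro _ ⟨v, hv, rfl⟩
  exact ⟨v, hv, fun k => rfl⟩

/-- Its role is to make the invariant Borel measurable, as the recurrence argument requires. -/
theorem upperSemicontinuous_cosetOrbitDim [CompleteSpace K] (d : ℕ) :
    UpperSemicontinuous (cosetOrbitDim d : (Fin m → G ⧸ H) → ℕ) := by
  intro x r hr
  have h1 := image_mk_mem_nhds (H := H) (b := fun k => (x k).out)
    (eventually_orbitDim_le G (H.map G.subtype) d fun k => ((x k).out : GL (Fin n) K))
  simp only [QuotientGroup.out_eq'] at h1
  filter_upwards [h1] with y ⟨v, hv, hvy⟩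
  refine lt_of_le_of_lt ?_ hr
  rw [cosetOrbitDim_eq_of_mk_eq d y v 1 fun k => by rw [hvy, one_smul]]
  exact hv

/-- If translates of `x` converge to a point `y` with the same orbit dimensions, then `y` lies in
the orbit of `x`, and the translates are eventually close to `y` along the orbit. -/
theorem eventually_exists_smul_eq [CompleteSpace K] [CharZero K] (hG : IsAlgebraicSubgroup G)
    (hH : IsAlgebraicSubgroup (H.map G.subtype)) {x y : Fin m → G ⧸ H} {ι : Type*} {l : Filter ι}
    [l.NeBot] {g : ι → G} (hg : Tendsto (fun i k => g i • x k) l (𝓝 y))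
    (hd : ∀ d, cosetOrbitDim d x = cosetOrbitDim d y) {U : Set G} (hU : U ∈ 𝓝 (1 : G)) :
    ∀ᶠ i in l, ∃ c ∈ U, ∀ k, g i • x k = c • y k := by
  set a : Fin m → G := fun k => (x k).out with ha
  set b : Fin m → G := fun k => (y k).out with hb
  have hay : ∀ k, (a k : G ⧸ H) = x k := fun k => QuotientGroup.out_eq' _
  have hby : ∀ k, (b k : G ⧸ H) = y k := fun k => QuotientGroup.out_eq' _
  have hlift : ∀ V ∈ 𝓝 (fun k => (b k : GL (Fin n) K)), ∀ᶠ i in l, ∃ v : Fin m → G,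
      (fun k => (v k : GL (Fin n) K)) ∈ V ∧ (∀ k, (v k : G ⧸ H) = g i • x k) ∧
      (fun k => (v k : GL (Fin n) K)) ∈
        tupleOrbit G (H.map G.subtype) (fun k => (a k : GL (Fin n) K)) := by
    intro V hV
    have h1 := image_mk_mem_nhds (H := H) hV
    simp only [hby] at h1
    filter_upwards [hg h1] with i ⟨v, hv, hvx⟩
    exact ⟨v, hv, hvx, coe_mem_tupleOrbit_of_mk_eq (g := g i) fun k => by rw [hvx, hay]⟩
  have hcl : (fun k => (b k : GL (Fin n) K)) ∈
      closure (tupleOrbit G (H.map G.subtype) (fun k => (a k : GL (Fin n) K))) := by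
    rw [mem_closure_iff_nhds]
    intro V hV
    obtain ⟨i, v, hv, -, hvo⟩ := (hlift V hV).exists
    exact ⟨_, hv, hvo⟩
  -- The lifts lie in the orbit of `a`, while openness is available around `b`. Equality of the two
  -- ideals shows that the lifts satisfy the equations of the orbit of `b`.
  have hideal := orbitIdeal_eq_of_le_of_orbitDim_eq (orbitIdeal_le_of_mem_closure hcl) hd
  obtain ⟨U', hU', hUU⟩ := mem_nhds_induced (Subtype.val : G → GL (Fin n) K) 1 U |>.1 hU
  filter_upwards [hlift _ (eventually_mem_tupleOrbit hG hH _ hU')] with i ⟨v, hv, hvx, hvo⟩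
  obtain ⟨c, hcU, hcG, h, hh, hvc⟩ := hv fun p hp => by
    rw [← hideal] at hp
    exact hp _ hvo
  refine ⟨⟨c, hcG⟩, hUU hcU, fun k => ?_⟩
  rw [← hvx, ← hby]
  obtain ⟨h', hh', hh'k⟩ := hh k
  have : v k = (⟨c, hcG⟩ * b k) * h' := by
    refine Subtype.ext ?_
    rw [congrFun hvc k, ← hh'k]
    rfl
  rw [this, QuotientGroup.mk_mul_of_mem _ hh']
  rfl

end OrbitDimension

/-! ### Recurrence in the infinite power of `μ`. -/

section Recurrence

/-- The limsup set is the decreasing intersection of the tail unions, each of measure at least `δ`;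
finiteness of `P` gives continuity from above. -/
theorem exists_frequently_mem {Ω : Type*} [MeasurableSpace Ω] {P : Measure Ω} [IsFiniteMeasure P]
    {S : ℕ → Set Ω} (hS : ∀ i, MeasurableSet (S i)) {δ : ENNReal} (hδ : ∀ i, δ ≤ P (S i)) :
    δ ≤ P {x | ∃ᶠ i in atTop, x ∈ S i} := by
  have h1 : {x | ∃ᶠ i in atTop, x ∈ S i} = ⋂ N : ℕ, ⋃ i ≥ N, S i := by
    ext x
    simp [frequently_atTop]
  rw [h1]
  have hanti : Antitone fun N : ℕ => ⋃ i ≥ N, S i := fun N M hNM =>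
    Set.iUnion_mono fun i => Set.iUnion_mono' fun h => ⟨hNM.trans h, le_rfl⟩
  have h2 := tendsto_measure_iInter_atTop (μ := P) (s := fun N : ℕ => ⋃ i ≥ N, S i)
    (fun N => (MeasurableSet.iUnion fun i => MeasurableSet.iUnion fun _ => hS i).nullMeasurableSet)
    hanti ⟨0, measure_ne_top _ _⟩
  refine ge_of_tendsto' h2 fun N => (hδ N).trans (measure_mono ?_)
  exact Set.subset_iUnion₂_of_subset N le_rfl le_rfl

theorem infinitePi_forall_notMem_eq_zero {X : Type*} [MeasurableSpace X] (μ : Measure X)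
    [IsProbabilityMeasure μ] {U : Set X} (hU : MeasurableSet U) (hμ : μ U ≠ 0) :
    Measure.infinitePi (fun _ : ℕ => μ) {x | ∀ k, x k ∉ U} = 0 := by
  have h1 : ∀ M : ℕ, Measure.infinitePi (fun _ : ℕ => μ) {x | ∀ k, x k ∉ U} ≤ μ Uᶜ ^ M := by
    intro M
    have hsub : {x : ℕ → X | ∀ k, x k ∉ U} ⊆ Set.pi (Finset.range M : Set ℕ) fun _ => Uᶜ :=
      fun x hx k _ => hx k
    refine (measure_mono hsub).trans ?_
    rw [Measure.infinitePi_pi _ fun _ _ => hU.compl]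
    simp
  have h2 : μ Uᶜ < 1 := by
    rw [prob_compl_eq_one_sub hU]
    exact ENNReal.sub_lt_self ENNReal.one_ne_top one_ne_zero hμ
  exact le_antisymm (ge_of_tendsto' (ENNReal.tendsto_pow_atTop_nhds_zero_of_lt_one h2) h1)
    zero_le

/-- An independent random sequence almost surely visits every set of positive measure from a
countable basis. -/
theorem ae_infinitePi_support_subset_closure_range {X : Type*} [TopologicalSpace X]
    [SecondCountableTopology X] [MeasurableSpace X] [BorelSpace X] (μ : Measure X)
    [IsProbabilityMeasure μ] :
    ∀ᵐ x ∂(Measure.infinitePi fun _ : ℕ => μ), μ.support ⊆ closure (Set.range x) := by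
  have hb := TopologicalSpace.isBasis_countableBasis X
  have h1 : ∀ᵐ x ∂(Measure.infinitePi fun _ : ℕ => μ),
      ∀ U ∈ TopologicalSpace.countableBasis X, μ U ≠ 0 → ∃ k, x k ∈ U := by
    rw [ae_ball_iff (TopologicalSpace.countable_countableBasis X)]
    intro U hU
    by_cases hμ : μ U = 0
    · exact Eventually.of_forall fun x h => absurd hμ h
    · have := infinitePi_forall_notMem_eq_zero μ (hb.isOpen hU).measurableSet hμ
      rw [measure_eq_zero_iff_ae_notMem] at this
      filter_upwards [this] with x hx _
      by_contra! h
      exact hx h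
  filter_upwards [h1] with x hx s hs
  rw [hb.mem_closure_iff]
  intro U hU hsU
  obtain ⟨k, hk⟩ := hx U hU ((Measure.mem_support_iff_forall s).1 hs U
    ((hb.isOpen hU).mem_nhds hsU)).ne'
  exact ⟨x k, hk, k, rfl⟩

variable {X : Type*} [TopologicalSpace X] [T2Space X] [SecondCountableTopology X]
  [LocallyCompactSpace X] [MeasurableSpace X] [BorelSpace X] (μ : Measure X)
  [IsProbabilityMeasure μ]

/-- Inner regularity lets the masses left out in the separate coordinates have sum less than one. -/
theorem exists_isCompact_pi_measure_pos :
    ∃ C : ℕ → Set X, (∀ k, IsCompact (C k)) ∧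
      0 < Measure.infinitePi (fun _ : ℕ => μ) (Set.pi Set.univ C) := by
  have : TopologicalSpace.MetrizableSpace X := TopologicalSpace.metrizableSpace_of_t3_secondCountable X
  obtain ⟨ε, hε0, hε⟩ := ENNReal.exists_pos_sum_of_countable' (ε := 1) one_ne_zero ℕ
  have hC : ∀ k, ∃ C : Set X, IsCompact C ∧ μ Cᶜ < ε k := by
    intro k
    obtain ⟨C, -, hC, h⟩ := MeasurableSet.univ.exists_isCompact_sdiff_lt (μ := μ)
      (measure_ne_top _ _) (hε0 k).ne'
    exact ⟨C, hC, by rwa [Set.compl_eq_univ_sdiff]⟩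
  choose C hC hCε using hC
  refine ⟨C, hC, ?_⟩
  have hm : MeasurableSet (Set.pi Set.univ C) :=
    MeasurableSet.pi Set.countable_univ fun k _ => (hC k).measurableSet
  have h1 : Measure.infinitePi (fun _ : ℕ => μ) (Set.pi Set.univ C)ᶜ < 1 := by
    have hsub : (Set.pi Set.univ C)ᶜ ⊆ ⋃ k, (fun x : ℕ → X => x k) ⁻¹' (C k)ᶜ := by
      intro x hx
      simpa [Set.mem_pi] using hx
    refine ((measure_mono hsub).trans (measure_iUnion_le _)).trans_lt (lt_of_le_of_lt ?_ hε)
    refine ENNReal.tsum_le_tsum fun k => ?_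
    rw [(measurePreserving_eval_infinitePi (fun _ : ℕ => μ) k).measure_preimage
      (hC k).measurableSet.compl.nullMeasurableSet]
    exact (hCε k).le
  rw [prob_compl_eq_one_sub hm] at h1
  rw [pos_iff_ne_zero]
  intro h0
  rw [h0, tsub_zero] at h1
  exact lt_irrefl _ h1

/-- Under transformations preserving `μ`, some sequence of points whose closure contains the
support of `μ` has a subsequence of translates converging to a sequence with the same value of
a given measurable invariant. -/
theorem exists_recurrent_sequence {Z : Type*} [TopologicalSpace Z] [TopologicalSpace.MetrizableSpace Z]
    [SecondCountableTopology Z] [MeasurableSpace Z] [BorelSpace Z] (g : ℕ → X → X)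
    (hg : ∀ i, Measurable (g i)) (hgμ : ∀ i, μ.map (g i) = μ) (f : (ℕ → X) → Z)
    (hf : Measurable f) (hfg : ∀ i x, f (fun k => g i (x k)) = f x) :
    ∃ x y : ℕ → X, μ.support ⊆ closure (Set.range x) ∧ f x = f y ∧
      ∃ φ : ℕ → ℕ, StrictMono φ ∧ Tendsto (fun i k => g (φ i) (x k)) atTop (𝓝 y) := by
  have : TopologicalSpace.MetrizableSpace X := TopologicalSpace.metrizableSpace_of_t3_secondCountable X
  set P := Measure.infinitePi fun _ : ℕ => μ with hP
  obtain ⟨C, hC, hCP⟩ := exists_isCompact_pi_measure_pos μ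
  set T : Set (ℕ → X) := Set.pi Set.univ C with hT
  have hTc : IsCompact T := isCompact_univ_pi hC
  have hTm : MeasurableSet T := hTc.measurableSet
  have hgr : Measurable fun x : ℕ → X => (x, f x) := measurable_id.prodMk hf
  set ν := P.map fun x : ℕ → X => (x, f x) with hν
  have hνf : IsFiniteMeasure ν := Measure.isFiniteMeasure_map _ _
  -- A substitute for Lusin's theorem: a closed subset `F` of the graph of `f` over `T`, of positive
  -- measure, makes the relation with the value of `f` survive limits.
  let E : Set ((ℕ → X) × Z) := {p | f p.1 = p.2} ∩ Prod.fst ⁻¹' T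
  have hE : MeasurableSet E :=
    (measurableSet_eq_fun (hf.comp measurable_fst) measurable_snd).inter (measurable_fst hTm)
  have hνE : 0 < ν E := by
    rw [hν, Measure.map_apply hgr hE]
    refine hCP.trans_le (measure_mono fun x hx => ⟨rfl, hx⟩)
  obtain ⟨F, hFE, hFc, hF⟩ := hE.exists_lt_isClosed_of_ne_top (measure_ne_top ν E) hνE
  set S : Set (ℕ → X) := {x | (x, f x) ∈ F} with hS
  have hSm : MeasurableSet S := hgr hFc.measurableSet
  have hSP : 0 < P S := by
    rwa [hν, Measure.map_apply hgr hFc.measurableSet] at hF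
  have hGm : ∀ i, Measurable fun (x : ℕ → X) k => g i (x k) := fun i =>
    measurable_pi_lambda _ fun k => (hg i).comp (measurable_pi_apply k)
  have hGP : ∀ i, P.map (fun (x : ℕ → X) k => g i (x k)) = P := by
    intro i
    rw [hP, Measure.infinitePi_map_pi (μ := fun _ : ℕ => μ) (f := fun _ => g i) fun _ => hg i]
    simp only [hgμ]
  have hlim := exists_frequently_mem (P := P) (S := fun i => (fun (x : ℕ → X) k => g i (x k)) ⁻¹' S)
    (fun i => hGm i hSm) (δ := P S) fun i => by
      rw [← Measure.map_apply (hGm i) hSm, hGP]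
  obtain ⟨x, hxf, hxs⟩ : ∃ x, (∃ᶠ i in atTop, (fun k => g i (x k)) ∈ S) ∧
      μ.support ⊆ closure (Set.range x) := by
    have h1 : ∃ᵐ x ∂P, ∃ᶠ i in atTop, (fun k => g i (x k)) ∈ S :=
      frequently_ae_iff.2 (hSP.trans_le hlim).ne'
    exact (h1.and_eventually (ae_infinitePi_support_subset_closure_range μ)).exists
  obtain ⟨φ, hφ, hφS⟩ := extraction_of_frequently_atTop hxf
  obtain ⟨y, -, ψ, hψ, hy⟩ := hTc.tendsto_subseq fun i => (hFE (hφS i)).2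
  refine ⟨x, y, hxs, ?_, φ ∘ ψ, hφ.comp hψ, hy⟩
  -- By invariance the second coordinate is constantly `f x` along the translates, so the limit
  -- point stays in the closed set `F`.
  have hyF : (y, f x) ∈ F := by
    refine hFc.mem_of_tendsto (hy.prodMk_nhds tendsto_const_nhds) (Eventually.of_forall fun i => ?_)
    have := hφS (ψ i)
    rw [hS, Set.mem_ofPred_eq, hfg] at this
    exact this
  exact (hFE hyF).1.symm

end Recurrence

/-! ### Closedness, normality and the chain condition for stabilizers. -/

section StabilizerCompactness

theorem IsAlgebraicSubgroup.isClosed {K : Type*} [NontriviallyNormedField K] {n : ℕ}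
    {G : Subgroup (GL (Fin n) K)} (hG : IsAlgebraicSubgroup G) :
    IsClosed (G : Set (GL (Fin n) K)) := by
  obtain ⟨S, hS⟩ := hG
  have : (G : Set (GL (Fin n) K)) = ⋂ p ∈ S, {g : GL (Fin n) K | MvPolynomial.eval
      (fun ij : Fin n × Fin n => (g : Matrix (Fin n) (Fin n) K) ij.1 ij.2) p = 0} := by
    ext g
    simpa using hS g
  rw [this]
  refine isClosed_biInter fun p _ => isClosed_eq ?_ continuous_const
  exact (MvPolynomial.continuous_eval p).comp
    (continuous_pi fun ij => Units.continuous_val.matrix_elem ij.1 ij.2)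

theorem isClosed_of_map_subtype {K : Type*} [NontriviallyNormedField K] {n : ℕ}
    {G : Subgroup (GL (Fin n) K)} {H : Subgroup G}
    (hH : IsAlgebraicSubgroup (H.map G.subtype)) : IsClosed (H : Set G) := by
  have : (H : Set G) = Subtype.val ⁻¹' (H.map G.subtype : Set (GL (Fin n) K)) := by
    ext g
    simp
  rw [this]
  exact hH.isClosed.preimage continuous_subtype_val

theorem exists_eval_conj_eq {K : Type*} [Field K] {n : ℕ} (a : GL (Fin n) K)
    (p : MvPolynomial (Fin n × Fin n) K) :
    ∃ p' : MvPolynomial (Fin n × Fin n) K, ∀ w : GL (Fin n) K,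
      MvPolynomial.eval (fun ij => (w : Matrix (Fin n) (Fin n) K) ij.1 ij.2) p' =
        MvPolynomial.eval
          (fun ij => ((a⁻¹ * w * a : GL (Fin n) K) : Matrix (Fin n) (Fin n) K) ij.1 ij.2) p := by
  refine ⟨MvPolynomial.bind₁ (fun t => ∑ j, (∑ i, MvPolynomial.C
    (((a⁻¹ : GL (Fin n) K) : Matrix (Fin n) (Fin n) K) t.1 i) * MvPolynomial.X (i, j)) *
      MvPolynomial.C ((a : Matrix (Fin n) (Fin n) K) j t.2)) p, fun w => ?_⟩
  rw [← MvPolynomial.aeval_eq_eval, ← MvPolynomial.aeval_eq_eval, MvPolynomial.aeval_bind₁]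
  congr 2
  funext t
  simp only [Units.val_mul, Matrix.mul_apply, map_sum, map_mul, MvPolynomial.aeval_C,
    MvPolynomial.aeval_X]
  rfl

/-- The intersection of a sequence of conjugates of an algebraic group is already the intersection
of finitely many of them. -/
theorem IsAlgebraicSubgroup.exists_forall_conj_mem {K : Type*} [Field K] {n : ℕ}
    {H : Subgroup (GL (Fin n) K)} (hH : IsAlgebraicSubgroup H) (a : ℕ → GL (Fin n) K) :
    ∃ m, ∀ g, (∀ k < m, (a k)⁻¹ * g * a k ∈ H) → ∀ k, (a k)⁻¹ * g * a k ∈ H := by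
  obtain ⟨S, hS⟩ := hH
  -- `J m` is the vanishing ideal of the intersection of the first `m` conjugates; this ascending
  -- chain stabilizes. The equations of any later conjugate therefore already belong to `J m`.
  let J : ℕ →o Ideal (MvPolynomial (Fin n × Fin n) K) :=
    { toFun := fun m =>
        { carrier := {p | ∀ g : GL (Fin n) K, (∀ k < m, (a k)⁻¹ * g * a k ∈ H) →
            MvPolynomial.eval (fun ij => (g : Matrix (Fin n) (Fin n) K) ij.1 ij.2) p = 0}
          zero_mem' := fun _ _ => map_zero _
          add_mem' := fun hp hq g hg => by rw [map_add, hp g hg, hq g hg, add_zero]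
          smul_mem' := fun c p hp g hg => by rw [smul_eq_mul, map_mul, hp g hg, mul_zero] }
      monotone' := fun m M hmM p hp g hg => hp g fun k hk => hg k (hk.trans_le hmM) }
  obtain ⟨m, hm⟩ := monotone_stabilizes_iff_noetherian.2
    (inferInstanceAs (IsNoetherianRing (MvPolynomial (Fin n × Fin n) K))) J
  refine ⟨m, fun g hg k => (hS _).2 fun p hp => ?_⟩
  obtain ⟨p', hp'⟩ := exists_eval_conj_eq (a k) p
  have h1 : p' ∈ J (max m (k + 1)) := fun w hw => by
    rw [hp']
    exact (hS _).1 (hw k (lt_max_of_lt_right k.lt_succ_self)) p hp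
  rw [← hm _ (le_max_left _ _)] at h1
  rw [← hp']
  exact h1 g hg

/-- On a metrizable space, integrals of bounded continuous functions determine a finite measure, and
by dominated convergence these integrals vary continuously with `g`. -/
theorem isClosed_measureStabilizer {G X : Type*} [Group G] [TopologicalSpace G]
    [FirstCountableTopology G] [MulAction G X] [TopologicalSpace X]
    [TopologicalSpace.MetrizableSpace X] [MeasurableSpace X] [BorelSpace X] [ContinuousSMul G X]
    (μ : Measure X) [IsFiniteMeasure μ] : IsClosed (measureStabilizer G μ : Set G) := by
  let _ := TopologicalSpace.metrizableSpaceMetric X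
  have key : (measureStabilizer G μ : Set G) =
      ⋂ f : BoundedContinuousFunction X ℝ, {g | ∫ x, f (g • x) ∂μ = ∫ x, f x ∂μ} := by
    ext g
    have hm : Measurable fun x : X => g • x := (continuous_const_smul g).measurable
    have hint : ∀ f : BoundedContinuousFunction X ℝ,
        ∫ x, f x ∂(μ.map fun x => g • x) = ∫ x, f (g • x) ∂μ := fun f =>
      integral_map hm.aemeasurable f.continuous.aestronglyMeasurable
    simp only [Set.mem_iInter]
    constructor
    · intro hg f
      have hg' : μ.map (fun x => g • x) = μ := hg
      change ∫ x, f (g • x) ∂μ = _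
      rw [← hint, hg']
    · intro h
      have : IsFiniteMeasure (μ.map fun x => g • x) := Measure.isFiniteMeasure_map _ _
      exact ext_of_forall_integral_eq_of_IsFiniteMeasure fun f => (hint f).trans (h f)
  rw [key]
  refine isClosed_iInter fun f => isClosed_eq ?_ continuous_const
  refine continuous_of_dominated (bound := fun _ => ‖f‖) (fun g => ?_) (fun g => ?_)
    (integrable_const _) (Eventually.of_forall fun x => ?_)
  · exact (f.continuous.comp (continuous_const_smul g)).aestronglyMeasurable
  · exact Eventually.of_forall fun x => f.norm_coe_le_norm _
  · exact f.continuous.comp (continuous_id.smul continuous_const)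

variable {G X : Type*} [Group G] [MulAction G X] [TopologicalSpace X] [MeasurableSpace X]

theorem mem_supportFixer_iff {μ : Measure X} {g : G} :
    g ∈ supportFixer G μ ↔ ∀ x ∈ μ.support, g • x = x := by
  rw [supportFixer, mem_fixingSubgroup_iff]

theorem isClosed_supportFixer [T2Space X] [TopologicalSpace G] [ContinuousSMul G X]
    (μ : Measure X) : IsClosed (supportFixer G μ : Set G) := by
  have : (supportFixer G μ : Set G) = ⋂ x ∈ μ.support, {g | g • x = x} := by
    ext g
    simp [mem_supportFixer_iff]
  rw [this]
  exact isClosed_biInter fun x _ =>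
    isClosed_eq (continuous_id.smul continuous_const) continuous_const

theorem mem_supportFixer_of_subset_closure [T2Space X] [ContinuousConstSMul G X] {μ : Measure X}
    {s : Set X} (hs : μ.support ⊆ closure s) {g : G} (hg : ∀ x ∈ s, g • x = x) :
    g ∈ supportFixer G μ := by
  rw [mem_supportFixer_iff]
  intro x hx
  exact closure_minimal (t := {x | g • x = x}) hg
    (isClosed_eq (continuous_const_smul g) continuous_id) (hs hx)

variable [ContinuousConstSMul G X] [BorelSpace X]

theorem supportFixer_le_measureStabilizer [SecondCountableTopology X] (μ : Measure X) :
    supportFixer G μ ≤ measureStabilizer G μ := by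
  intro g hg
  change μ.map (fun x => g • x) = μ
  have h : (fun x : X => g • x) =ᵐ[μ] id := by
    filter_upwards [Measure.support_mem_ae (μ := μ)] with x hx
    exact mem_supportFixer_iff.1 hg x hx
  rw [Measure.map_congr h, Measure.map_id]

theorem smul_mem_support {μ : Measure X} {g : G} (hg : g ∈ measureStabilizer G μ) {x : X}
    (hx : x ∈ μ.support) : g • x ∈ μ.support := by
  rw [Measure.mem_support_iff_forall] at hx ⊢
  intro U hU
  have hg' : μ.map (fun x => g • x) = μ := hg
  have h1 := hx _ ((continuous_const_smul g).continuousAt.preimage_mem_nhds hU)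
  rw [← hg']
  exact h1.trans_le (Measure.le_map_apply (continuous_const_smul g).measurable.aemeasurable U)

theorem normal_supportFixer_subgroupOf (μ : Measure X) :
    ((supportFixer G μ).subgroupOf (measureStabilizer G μ)).Normal := by
  refine ⟨fun a ha g => ?_⟩
  rw [Subgroup.mem_subgroupOf, mem_supportFixer_iff] at ha ⊢
  intro x hx
  have h1 := ha _ (smul_mem_support (g⁻¹).2 hx)
  change ((g : G) * a * (g : G)⁻¹) • x = x
  rw [mul_smul, mul_smul]
  have h2 : (a : G) • (g : G)⁻¹ • x = (g : G)⁻¹ • x := h1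
  rw [h2, smul_inv_smul]

end StabilizerCompactness

/-! ### Topology of the general linear group over a local field. -/

section LocalField

variable {K : Type*} [NontriviallyNormedField K] [LocallyCompactSpace K] {n : ℕ}

theorem secondCountableTopology_generalLinearGroup :
    SecondCountableTopology (GL (Fin n) K) := by
  have : ProperSpace K := ProperSpace.of_locallyCompactSpace K
  have : SecondCountableTopology (Matrix (Fin n) (Fin n) K) :=
    inferInstanceAs (SecondCountableTopology (Fin n → Fin n → K))
  have : SecondCountableTopology (Matrix (Fin n) (Fin n) K)ᵐᵒᵖ :=
    MulOpposite.opHomeomorph.symm.isEmbedding.secondCountableTopology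
  exact Units.isEmbedding_embedProduct.secondCountableTopology

theorem locallyCompactSpace_generalLinearGroup : LocallyCompactSpace (GL (Fin n) K) := by
  have : LocallyCompactSpace (Matrix (Fin n) (Fin n) K) :=
    inferInstanceAs (LocallyCompactSpace (Fin n → Fin n → K))
  have : T2Space (Matrix (Fin n) (Fin n) K) := inferInstanceAs (T2Space (Fin n → Fin n → K))
  infer_instance

end LocalField

/-! ### Compactness of the quotient. -/

theorem corollary1 {K : Type*} [NontriviallyNormedField K] [LocallyCompactSpace K] [CharZero K]
    {n : ℕ} (G : Subgroup (GL (Fin n) K)) (hG : IsAlgebraicSubgroup G)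
    (H : Subgroup G) (hH : IsAlgebraicSubgroup (H.map G.subtype))
    [MeasurableSpace (G ⧸ H)] [BorelSpace (G ⧸ H)]
    (μ : Measure (G ⧸ H)) [IsProbabilityMeasure μ] :
    supportFixer G μ ≤ measureStabilizer G μ ∧
    ((supportFixer G μ).subgroupOf (measureStabilizer G μ)).Normal ∧
    CompactSpace (measureStabilizer G μ ⧸ (supportFixer G μ).subgroupOf (measureStabilizer G μ)) ∧
    T2Space (measureStabilizer G μ ⧸ (supportFixer G μ).subgroupOf (measureStabilizer G μ)) := by
  have : ProperSpace K := ProperSpace.of_locallyCompactSpace K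
  have : SecondCountableTopology (GL (Fin n) K) := secondCountableTopology_generalLinearGroup
  have : LocallyCompactSpace (GL (Fin n) K) := locallyCompactSpace_generalLinearGroup
  have : SecondCountableTopology G :=
    Topology.IsEmbedding.subtypeVal.secondCountableTopology
  have : LocallyCompactSpace G := hG.isClosed.isClosedEmbedding_subtypeVal.locallyCompactSpace
  have : IsClosed (H : Set G) := isClosed_of_map_subtype hH
  have : TopologicalSpace.MetrizableSpace (G ⧸ H) :=
    TopologicalSpace.metrizableSpace_of_t3_secondCountable _
  have hle := supportFixer_le_measureStabilizer (G := G) μ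
  have hnormal := normal_supportFixer_subgroupOf (G := G) μ
  set I := measureStabilizer G μ with hI
  set N := (supportFixer G μ).subgroupOf I with hN
  have hNc : IsClosed (N : Set I) :=
    (isClosed_supportFixer (G := G) μ).preimage continuous_subtype_val
  have : SecondCountableTopology I :=
    Topology.IsEmbedding.subtypeVal.secondCountableTopology
  have hIc : IsClosed (I : Set G) := isClosed_measureStabilizer μ
  have : TopologicalSpace.MetrizableSpace (I ⧸ N) :=
    TopologicalSpace.metrizableSpace_of_t3_secondCountable _
  refine ⟨hle, hnormal, ?_, inferInstance⟩
  let _ := TopologicalSpace.metrizableSpaceMetric (I ⧸ N)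
  refine isCompact_univ_iff.1 (IsSeqCompact.isCompact fun q _ => ?_)
  choose s hs using fun i => QuotientGroup.mk_surjective (q i)
  -- The invariant records all tuple lengths and all degrees at once, because the length `m` is
  -- known only after `x` has been found.
  obtain ⟨x, y, hx, hxy, φ, hφ, hlim⟩ := exists_recurrent_sequence μ
    (fun i x => (s i : G) • x) (fun i => (continuous_const_smul (s i : G)).measurable)
    (fun i => (s i).2) (fun x (p : ℕ × ℕ) => cosetOrbitDim p.2 fun k : Fin p.1 => x k)
    (measurable_pi_lambda _ fun p => (upperSemicontinuous_cosetOrbitDim p.2).measurable.comp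
      (measurable_pi_lambda _ fun k => measurable_pi_apply _))
    (fun i x => funext fun p => cosetOrbitDim_smul _ _ _)
  obtain ⟨m, hm⟩ := hH.exists_forall_conj_mem fun k => ((x k).out : GL (Fin n) K)
  have hfix : ∀ (g : G) (k : ℕ), g • x k = x k ↔
      ((x k).out : GL (Fin n) K)⁻¹ * g * ((x k).out : GL (Fin n) K) ∈ H.map G.subtype := by
    intro g k
    have h1 : g • x k = x k ↔ ((x k).out : G)⁻¹ * g * (x k).out ∈ H := by
      conv_lhs => rw [← QuotientGroup.out_eq' (x k)]
      rw [eq_comm, MulAction.Quotient.smul_coe, smul_eq_mul, QuotientGroup.eq, mul_assoc]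
    rw [h1]
    constructor
    · exact fun h => ⟨_, h, rfl⟩
    · rintro ⟨h, hh, he⟩
      have : h = ((x k).out : G)⁻¹ * g * (x k).out := Subtype.ext he
      exact this ▸ hh
  have hstab : ∀ g : G, (∀ k : Fin m, g • x k = x k) → g ∈ supportFixer G μ := by
    intro g hg
    refine mem_supportFixer_of_subset_closure hx ?_
    rintro _ ⟨k, rfl⟩
    exact (hfix g k).2 (hm g (fun k hk => (hfix g k).1 (hg ⟨k, hk⟩)) k)
  have hlim' : Tendsto (fun i (k : Fin m) => (s (φ i) : G) • x k) atTop (𝓝 fun k : Fin m => y k) :=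
    tendsto_pi_nhds.2 fun k => tendsto_pi_nhds.1 hlim k
  have hev : ∀ U ∈ 𝓝 (1 : G), ∀ᶠ i in atTop, ∃ c ∈ U, ∀ k : Fin m, (s (φ i) : G) • x k = c • y k :=
    fun U hU => eventually_exists_smul_eq hG hH hlim' (fun d => congrFun hxy (m, d)) hU
  -- A single index suffices to write the limit as `y = g • x` on the first `m` entries; at this
  -- stage `g` is only known to lie in `G`.
  obtain ⟨i₀, c₀, -, h₀⟩ := (hev Set.univ univ_mem).exists
  set g : G := c₀⁻¹ * s (φ i₀) with hg
  have hgx : ∀ k : Fin m, y k = g • x k := fun k => by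
    rw [hg, mul_smul, h₀, inv_smul_smul]
  have hev' : ∀ U ∈ 𝓝 (1 : G), ∀ᶠ i in atTop, ∃ c ∈ U,
      (c * g)⁻¹ * s (φ i) ∈ supportFixer G μ := by
    intro U hU
    filter_upwards [hev U hU] with i ⟨c, hc, h⟩
    refine ⟨c, hc, hstab _ fun k => ?_⟩
    rw [mul_smul, h, hgx, ← mul_smul c, inv_smul_smul]
  have hmem : ∀ (c : G) (i : ℕ), (c * g)⁻¹ * s (φ i) ∈ supportFixer G μ → c * g ∈ I := by
    intro c i h
    have h1 := I.mul_mem (s (φ i)).2 (I.inv_mem (hle h))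
    rwa [mul_inv_rev, inv_inv, mul_inv_cancel_left] at h1
  have hnhds : ∀ V ∈ 𝓝 g, {c : G | c * g ∈ V} ∈ 𝓝 (1 : G) := fun V hV =>
    (continuous_mul_const g).continuousAt.preimage_mem_nhds (by rwa [one_mul])
  -- The elements `c * g` with `c` close to `1` lie in `I` and accumulate at `g`, and `I` is closed.
  have hgI : g ∈ I := by
    rw [← SetLike.mem_coe, ← hIc.closure_eq, mem_closure_iff_nhds]
    intro V hV
    obtain ⟨i, c, hc, h⟩ := (hev' _ (hnhds V hV)).exists
    exact ⟨c * g, hc, hmem c i h⟩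
  refine ⟨QuotientGroup.mk ⟨g, hgI⟩, trivial, φ, hφ, fun O hO => ?_⟩
  have hO' : (QuotientGroup.mk : I → I ⧸ N) ⁻¹' O ∈ 𝓝 (⟨g, hgI⟩ : I) :=
    QuotientGroup.continuous_mk.continuousAt.preimage_mem_nhds hO
  obtain ⟨V, hV, hVO⟩ := (mem_nhds_induced (Subtype.val : I → G) _ _).1 hO'
  change ∀ᶠ i in atTop, q (φ i) ∈ O
  filter_upwards [hev' _ (hnhds V hV)] with i ⟨c, hc, h⟩
  have h1 : (QuotientGroup.mk ⟨c * g, hmem c i h⟩ : I ⧸ N) = q (φ i) := by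
    rw [← hs, QuotientGroup.eq]
    exact h
  rw [← h1]
  exact hVO hc
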